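/- Let $K$ be an infinite field, $R=K[x_0,\dots,x_n]$ with the standard grading, and let $I\subsetneq R$ be a proper homogeneous ideal of codimension (height) at least two. **Definitions.** A *basic double link* of a homogeneous ideal $I$ of type $(d,a)$, $a\ge 1$, is an ideal $J=G\cdot I+(F)$, where $F\in I$ is a nonzero form of degree $d$ and $G\neq 0$ is a form of degree $a$ having no common factor with $F$. A homogeneous ideal $J$ is *numerically ACM* if $R/J$ has the same Hilbert function as $R/Q$ for some homogeneous ideal $Q$ of codimension two with $R/Q$ Cohen–Macaulay and, if $n\ge 2$, $Q$ saturated (so that for $n\ge2$, $Q$ is the ideal of a codimension two ACM subscheme of $\mathbb P^n$). Given a minimal graded free resolution $0\to F_{n+1}\to\cdots\to F_1\to R\to R/I\to 0$ with $F_p=\bigoplus_q R(-c_{p,q})$, let $\underline s$ be the multiset of all $c_{p,q}$ with $p\ge 2$ even and $\underline r$ the multiset of all $c_{p,q}$ with $p$ odd. Remove common elements of $\underline s$ and $\underline r$ pairwise, one at a time, and list what is left in non-increasing order, $s_1\ge s_2\ge\cdots$ and $r_1\ge r_2\ge\cdots$. Put $A=(s_i-r_j)$. *One step of the algorithm*: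 if the main diagonal of $A$ has a negative entry, take the one closest to the bottom right, say $s_i-r_i=-d<0$, and replace $I$ by a basic double link $J$ of $I$ of type $(r_i,d)$. Repeat with $J$. The algorithm stops when the main diagonal of $A$ has no negative entry. **Theorem.** 1. There is a finite sequence of basic double links, starting from $I$, that ends in a numerically ACM ideal. 2. $R/I$ has a minimal graded free resolution as above. For each such resolution, suppose that the main diagonal of $A$ has a negative entry, and let $-d=s_i-r_i$ be the one closest to the bottom right. Then $I$ contains a nonzero form of degree $r_i$. For every nonzero form $F\in I$ of degree $r_i$, a general form $G$ of degree $d$ is nonzero and has no common factor with $F$. Every basic double link $J$ of $I$ of type $(r_i,d)$ is a homogeneous ideal of codimension two, and the main diagonal of the matrix formed from any minimal free resolution of $R/J$ is the main diagonal of $A$ with its $i$-th entry removed. 3. Let $\ell$ be the number of negative entries on the main diagonal of $A$ for $I$. Whatever choices are made, after $N$ steps of the algorithm one has $N\le \ell$; the algorithm stops at the ideal reached if and only if $N=\ell$; and if $N<\ell$, another step is possible. In particular the algorithm terminates after exactly $\ell$ steps, and a run of $\ell$ steps exists. 4. The algorithm has an output, and every output (called a *numerical Macaulification* of $I$) is numerically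 ACM. -/

import Mathlib

open MvPolynomial

namespace NumMac

/-- The polynomial ring `K[x_0, …, x_n]`, with its standard grading. -/
abbrev PolyRing (K : Type*) [Field K] (n : ℕ) := MvPolynomial (Fin (n + 1)) K

variable {K : Type*} [Field K] {n : ℕ}

attribute [local instance] MvPolynomial.gradedAlgebra

/-- Homogeneous ideals for the standard grading. -/
def IsHomogeneousIdeal (I : Ideal (PolyRing K n)) : Prop :=
  I.IsHomogeneous (homogeneousSubmodule (Fin (n + 1)) K)

/-- The homogeneous maximal ideal `(x_0, …, x_n)`. -/
noncomputable def irrelevantIdeal (K : Type*) [Field K] (n : ℕ) : Ideal (PolyRing K n) :=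
  Ideal.span (Set.range X)

/-- The Hilbert function `t ↦ dim_K [R/I]_t`; here `[R/I]_t` is the image of `R_t` in `R/I`. -/
noncomputable def hilbertFunction (I : Ideal (PolyRing K n)) (t : ℕ) : ℕ :=
  Module.finrank K
    ((homogeneousSubmodule (Fin (n + 1)) K t).map (Ideal.Quotient.mkₐ K I).toLinearMap)

/-- `R/Q` is a Cohen-Macaulay graded ring: the homogeneous maximal ideal contains an
`R/Q`-regular sequence whose length is the Krull dimension of `R/Q` (depth equals dimension). -/
def IsCohenMacaulayQuotient (Q : Ideal (PolyRing K n)) : Prop :=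
  ∃ rs : List (PolyRing K n), (∀ f ∈ rs, f ∈ irrelevantIdeal K n) ∧
    RingTheory.Sequence.IsRegular (PolyRing K n ⧸ Q) rs ∧
    ((rs.length : ℕ∞) : WithBot ℕ∞) = ringKrullDim (PolyRing K n ⧸ Q)

/-- `Q` is saturated: `Q : (x_0, …, x_n) = Q`. -/
def IsSaturated (Q : Ideal (PolyRing K n)) : Prop :=
  ∀ f : PolyRing K n, (∀ i, X i * f ∈ Q) → f ∈ Q

/-- `Q` is the homogeneous ideal of an arithmetically Cohen-Macaulay subscheme of `ℙⁿ` of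
codimension `c`: it is homogeneous of codimension `c`, the ring `R/Q` is Cohen-Macaulay, and `Q` is
saturated. In the degenerate case `c = n + 1`, where the subscheme is empty, `Q` is allowed to be
any homogeneous ideal of codimension `n + 1` with Cohen-Macaulay quotient. -/
structure IsACMIdeal (c : ℕ) (Q : Ideal (PolyRing K n)) : Prop where
  homogeneous : IsHomogeneousIdeal Q
  codim : Q.height = c
  cohenMacaulay : IsCohenMacaulayQuotient Q
  saturated : c ≤ n → IsSaturated Q

/-- `J` is numerically `c`-ACM: `R/J` has the Hilbert function of a codimension `c`
ACM subscheme. -/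
def IsNumericallyRACM (c : ℕ) (J : Ideal (PolyRing K n)) : Prop :=
  IsHomogeneousIdeal J ∧
    ∃ Q : Ideal (PolyRing K n), IsACMIdeal c Q ∧ hilbertFunction J = hilbertFunction Q

/-- Numerically ACM means numerically `2`-ACM. -/
def IsNumericallyACM (J : Ideal (PolyRing K n)) : Prop := IsNumericallyRACM 2 J

/-- `J = G · I + (F)` is a basic double link of `I` of type `(d, a)`: `F ∈ I` is a nonzero form of
degree `d` and `G` is a form of degree `a ≥ 1` without common factor with `F` (for a fixed `F` this
is the condition on `G` which holds for general `G`). -/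
def IsBasicDoubleLink (d a : ℕ) (I J : Ideal (PolyRing K n)) : Prop :=
  ∃ F G : PolyRing K n, F ∈ I ∧ F ≠ 0 ∧ F.IsHomogeneous d ∧
    0 < a ∧ G ≠ 0 ∧ G.IsHomogeneous a ∧ IsRelPrime F G ∧
    J = Ideal.span {G} * I ⊔ Ideal.span {F}

/-- The property `P` holds for the general form of degree `a`: it holds on the set of forms
of degree `a` on which some nonzero polynomial `Φ` in the coefficients does not vanish (over an
infinite field, a nonempty Zariski open subset of `R_a`). -/
def ForGeneralForm (a : ℕ) (P : PolyRing K n → Prop) : Prop :=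
  ∃ Φ : MvPolynomial {m : Fin (n + 1) →₀ ℕ // m.degree = a} K, Φ ≠ 0 ∧
    ∀ G : PolyRing K n, G.IsHomogeneous a →
      MvPolynomial.eval (fun m => coeff m.1 G) Φ ≠ 0 → P G

/-- A minimal graded free resolution
`0 → F_{n+1} → ⋯ → F_2 → F_1 → R → R/I → 0`, `F_{p+1} = ⨁_{k < rank p} R(-shift p k)`.
The map `F_1 → R` is given by the row `gen`, and `F_{p+2} → F_{p+1}` by the matrix `d p`. -/
structure MinimalFreeResolution (I : Ideal (PolyRing K n)) where
  rank : ℕ → ℕ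
  shift : (p : ℕ) → Fin (rank p) → ℕ
  gen : Fin (rank 0) → PolyRing K n
  d : (p : ℕ) → Matrix (Fin (rank p)) (Fin (rank (p + 1))) (PolyRing K n)
  /-- `F_p = 0` for `p > n + 1`. -/
  length_le : ∀ p, n + 1 ≤ p → rank p = 0
  /-- The map `F_1 → R` is homogeneous of degree zero. -/
  gen_homogeneous : ∀ k, (gen k).IsHomogeneous (shift 0 k)
  /-- The maps `F_{p+2} → F_{p+1}` are homogeneous of degree zero: the `(i, j)` entry is a form of
  degree `shift (p + 1) j - shift p i` (zero if this number is negative). -/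
  d_homogeneous : ∀ p i j, ∀ m ∈ (d p i j).support, m.degree + shift p i = shift (p + 1) j
  /-- The image of `F_1 → R` is `I`. -/
  span_gen : Ideal.span (Set.range gen) = I
  /-- Exactness at `F_1`. -/
  exact_gen : LinearMap.ker (Fintype.linearCombination (PolyRing K n) gen) =
    LinearMap.range (d 0).mulVecLin
  /-- Exactness at `F_{p+2}`. -/
  exact_d : ∀ p, LinearMap.ker (d p).mulVecLin = LinearMap.range (d (p + 1)).mulVecLin
  /-- Minimality: no matrix entry has a nonzero constant term. -/
  gen_minimal : ∀ k, constantCoeff (gen k) = 0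
  d_minimal : ∀ p i j, constantCoeff (d p i j) = 0

/-- Remove the common elements of `a` and `b` pairwise, one at a time, from `a`, and list the
remaining elements in non-increasing order. -/
def cancelledList (a b : Multiset ℕ) : List ℕ := (a - b).sort (· ≥ ·)

/-- The list of the differences `s_i - r_i`. -/
def diagonalList (s r : List ℕ) : List ℤ := List.zipWith (fun x y => (x : ℤ) - (y : ℤ)) s r

namespace MinimalFreeResolution

variable {I : Ideal (PolyRing K n)} (ρ : MinimalFreeResolution I)

/-- The multiset of the shifts of `F_{p+1}`. -/
def shifts (p : ℕ) : Multiset ℕ := Finset.univ.val.map (ρ.shift p)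

/-- All shifts of the modules `F_q` with `q = p + 1` odd. -/
def oddShifts : Multiset ℕ := ∑ p ∈ (Finset.range (n + 1)).filter (fun p => Odd (p + 1)), ρ.shifts p

/-- All shifts of the modules `F_q` with `q = p + 1 ≥ 2` even. -/
def evenShifts : Multiset ℕ :=
  ∑ p ∈ (Finset.range (n + 1)).filter (fun p => Even (p + 1)), ρ.shifts p

/-- The list `r_1 ≥ r_2 ≥ ⋯`, after the common elements of the two lists have been removed. -/
def rList : List ℕ := cancelledList ρ.oddShifts ρ.evenShifts

/-- The list `s_1 ≥ s_2 ≥ ⋯`, after the common elements of the two lists have been removed. -/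
def sList : List ℕ := cancelledList ρ.evenShifts ρ.oddShifts

/-- The main diagonal of the matrix `A = (s_i - r_j)`. -/
def diagonal : List ℤ := diagonalList ρ.sList ρ.rList

/-- The number of negative entries on the main diagonal of `A`. -/
def numNegative : ℕ := ρ.diagonal.countP (fun e => decide (e < 0))

/-- `i` is the (zero-based) position of the negative entry of the main diagonal of `A` which is
closest to the bottom right; this entry is `-d`, and `r` is the element `r_i` in its column. -/
def IsFirstNegative (i r d : ℕ) : Prop :=
  ρ.diagonal[i]? = some (-(d : ℤ)) ∧ 0 < d ∧ ρ.rList[i]? = some r ∧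
    ∀ j, i < j → ∀ e, ρ.diagonal[j]? = some e → 0 ≤ e

end MinimalFreeResolution

/-- One pass of the algorithm: take a minimal free resolution of `R/I`, form the
matrix `A = (s_i - r_j)`, take the negative entry `-d` of its main diagonal closest to the bottom
right, lying in the column of `r`, and replace `I` by a basic double link of type `(r, d)`. -/
def AlgorithmStep (I J : Ideal (PolyRing K n)) : Prop :=
  ∃ (ρ : MinimalFreeResolution I) (i r d : ℕ),
    ρ.IsFirstNegative i r d ∧ IsBasicDoubleLink r d I J

/-- `S 0, S 1, …, S N` are the ideals produced by `N` passes of the algorithm applied to `I`. -/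
def IsAlgorithmRun (I : Ideal (PolyRing K n)) (N : ℕ) (S : ℕ → Ideal (PolyRing K n)) : Prop :=
  S 0 = I ∧ ∀ k < N, AlgorithmStep (S k) (S (k + 1))

/-- The algorithm stops at `J`: the matrix `A` of `J` has no negative entry on its
main diagonal. -/
def AlgorithmStops (J : Ideal (PolyRing K n)) : Prop :=
  ∃ ρ : MinimalFreeResolution J, ρ.numNegative = 0

/-- `J` is a numerical Macaulification of `I`: the output of a run of the algorithm on `I`. -/
def IsNumericalMacaulification (I J : Ideal (PolyRing K n)) : Prop :=
  ∃ N S, IsAlgorithmRun I N S ∧ S N = J ∧ AlgorithmStops J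

end NumMac

/-!
The matrix `A` depends on `I` only through its Hilbert series, so the proof is a computation with
the polynomial `N = 1 - ∑ T^r + ∑ T^s`, the sums over all odd and all even shifts of a resolution.
The Hilbert series of `R/I` is `N / (1 - T)^(n+1)` (`MinimalFreeResolution.quotSeries_mul`, from
exactness in each degree), and the lists `r` and `s` left after cancellation are the multisets of
exponents of the positive and of the negative terms of `1 - N`. In particular they do not depend on
the resolution. Resolutions exist because minimal syzygies can be iterated, and they are finite by
Hilbert's syzygy theorem (`rank_eq_zero_of_exact_of_minimal`), proved by setting one variable after
the other to zero.

*One step.* For `J = G I + (F)` of type `(r, d)` the exact sequence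
`0 → R(-r-d) → I(-d) ⊕ R(-r) → J → 0` gives `1 - N_J = T^d (1 - N) + T^r - T^(r+d)`. If `r = r_i`
and `r - d = s_i`, the two new terms cancel one copy of `T^d T^(s_i)` and one of `T^d T^(r_i)`: up
to a common shift by `d`, which does not change differences, `s_i` and `r_i` have been removed
(`MinimalFreeResolution.IsFirstNegative.diagonal_eq_eraseIdx`). So each step lowers the number of
negative diagonal entries by one. A form of degree `r_i` exists in `I`, as `1 - N` would otherwise
have no term `T^(r_i)`. A general `G` is coprime to `F`, because the multiples of a prime factor of
`F` lie in a hyperplane of the space of forms (`forGeneralForm_isRelPrime`). The height of `J` is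
found from `J ⊆ (F, G)` and from the primes containing `J` (`height_basicDoubleLink`).

*The output.* An ideal of height at least two contains two coprime forms, and comparison with the
complete intersection they define shows that `(1 - T)^2` divides `N`
(`MinimalFreeResolution.one_sub_X_sq_dvd_numerator`). So there is one more `r` than there are `s`.
If no diagonal entry is negative then `s_i > r_i` for all `i`. The coefficient of `T^t` in
`N / (1 - T)`, which is `1 - #{r_i ≤ t} + #{s_i ≤ t}`, is therefore `1` for `t` below the smallest
`r` and at most `0` from there on. Hence `N / (1 - T)^2` is the Hilbert series of a quotient of
`K[x_0, x_1]` by a lexicographic ideal of finite colength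
(`MinimalFreeResolution.exists_isHVector_of_numNegative_eq_zero`). The extension `Q` of that ideal
to `R` has height two, the variables `x_2, …, x_n` form a regular sequence on `R/Q`
(`isACMIdeal_lexIdeal`), and `R/Q` has the Hilbert function of the given ideal.
-/

namespace NumMac

variable {K : Type*} [Field K] {n : ℕ}

attribute [local instance] MvPolynomial.gradedAlgebra

/-! ### Counting monomials -/

/-- The generating function of the number of monomials of each degree in a set `V` of exponent
vectors. -/
noncomputable def countSeries (V : Set (Fin (n + 1) →₀ ℕ)) : PowerSeries ℤ :=
  PowerSeries.mk fun t => ((V ∩ {m | m.degree = t}).ncard : ℤ)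

lemma finite_inter_degree (V : Set (Fin (n + 1) →₀ ℕ)) (t : ℕ) :
    (V ∩ {m | m.degree = t}).Finite :=
  (Finsupp.finite_of_degree_eq t).subset Set.inter_subset_right

/-- If membership in `V` does not depend on the exponent of `x_j`, then `1 - T` times the
generating function of `V` is that of the part of `V` with exponent zero at `x_j`: multiplication by
`x_j` maps `V` onto the remaining part. -/
lemma countSeries_mul_one_sub {V : Set (Fin (n + 1) →₀ ℕ)} {j : Fin (n + 1)}
    (hV : ∀ m, m + Finsupp.single j 1 ∈ V ↔ m ∈ V) :
    countSeries V * (1 - PowerSeries.X) = countSeries (V ∩ {m | m j = 0}) := by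
  ext t
  rw [mul_sub, mul_one, map_sub]
  cases t with
  | zero =>
    simp only [countSeries, PowerSeries.coeff_mk, PowerSeries.coeff_zero_mul_X, sub_zero]
    congr 2
    ext m
    simp only [Finsupp.degree_eq_zero_iff, Set.mem_inter_iff, Set.mem_ofPred_eq]
    constructor
    · rintro ⟨h, rfl⟩; exact ⟨⟨h, rfl⟩, rfl⟩
    · rintro ⟨⟨h, -⟩, h'⟩; exact ⟨h, h'⟩
  | succ t =>
    simp only [countSeries, PowerSeries.coeff_mk, PowerSeries.coeff_succ_mul_X]
    have himg : ((· + Finsupp.single j 1) '' (V ∩ {m | m.degree = t})).ncard =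
        (V ∩ {m | m.degree = t}).ncard :=
      Set.ncard_image_of_injective _ (add_left_injective _)
    have hdecomp : V ∩ {m | m.degree = t + 1} =
        (V ∩ {m | m j = 0} ∩ {m | m.degree = t + 1}) ∪
          ((· + Finsupp.single j 1) '' (V ∩ {m | m.degree = t})) := by
      ext m
      simp only [Set.mem_inter_iff, Set.mem_ofPred_eq, Set.mem_union, Set.mem_image]
      constructor
      · rintro ⟨h1, h2⟩
        by_cases h : m j = 0
        · exact Or.inl ⟨⟨h1, h⟩, h2⟩
        · have hle : Finsupp.single j 1 ≤ m := by
            rw [Finsupp.single_le_iff]; omega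
          have hm := tsub_add_cancel_of_le hle
          refine Or.inr ⟨m - Finsupp.single j 1, ⟨?_, ?_⟩, hm⟩
          · rw [← hV, hm]; exact h1
          · rw [← hm, map_add, Finsupp.degree_single] at h2
            omega
      · rintro (⟨⟨h1, -⟩, h2⟩ | ⟨m, ⟨h1, h2⟩, rfl⟩)
        · exact ⟨h1, h2⟩
        · exact ⟨(hV m).2 h1, by rw [map_add, Finsupp.degree_single, h2]⟩
    rw [hdecomp, Set.ncard_union_eq ?_ (finite_inter_degree _ _)
      ((finite_inter_degree _ _).image _), himg]
    · push_cast; ring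
    · rw [Set.disjoint_left]
      rintro _ ⟨⟨-, h⟩, -⟩ ⟨m, -, rfl⟩
      simp at h

lemma countSeries_mul_one_sub_pow {V : Set (Fin (n + 1) →₀ ℕ)} (s : Finset (Fin (n + 1)))
    (hV : ∀ j ∈ s, ∀ m, m + Finsupp.single j 1 ∈ V ↔ m ∈ V) :
    countSeries V * (1 - PowerSeries.X) ^ s.card = countSeries (V ∩ {m | ∀ j ∈ s, m j = 0}) := by
  classical
  induction s using Finset.induction_on with
  | empty => simp
  | insert i s hi ih =>
    rw [Finset.card_insert_of_notMem hi, pow_succ, ← mul_assoc,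
      ih fun j hj => hV j (Finset.mem_insert_of_mem hj), countSeries_mul_one_sub (j := i)]
    · congr 1
      ext m
      simp only [Set.mem_inter_iff, Set.mem_ofPred_eq, Finset.forall_mem_insert]
      tauto
    · intro m
      have : ∀ j ∈ s, (Finsupp.single i 1 : Fin (n + 1) →₀ ℕ) j = 0 := fun j hj =>
        Finsupp.single_eq_of_ne (by rintro rfl; exact hi hj)
      simp only [Set.mem_inter_iff, hV i (Finset.mem_insert_self _ _), Set.mem_ofPred_eq,
        Finsupp.add_apply]
      refine and_congr_right fun _ => forall₂_congr fun j hj => ?_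
      rw [this j hj, add_zero]

lemma countSeries_univ : countSeries (n := n) Set.univ * (1 - PowerSeries.X) ^ (n + 1) = 1 := by
  have h := countSeries_mul_one_sub_pow (n := n) (V := Set.univ) Finset.univ (by simp)
  rw [Finset.card_univ, Fintype.card_fin] at h
  rw [h]
  ext t
  rw [countSeries, PowerSeries.coeff_mk, PowerSeries.coeff_one]
  have : (Set.univ ∩ {m : Fin (n + 1) →₀ ℕ | ∀ j ∈ Finset.univ, m j = 0}) = {0} := by
    ext m; simp [Finsupp.ext_iff]
  rw [this]
  split_ifs with h
  · subst h
    rw [Set.inter_eq_left.2 (by simp)]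
    simp
  · rw [Set.inter_comm, Set.inter_singleton_eq_empty.2 (by simpa using Ne.symm h)]
    simp

/-! ### Hilbert series -/

lemma finrank_restrictSupport {σ : Type*} {s : Set (σ →₀ ℕ)} :
    Module.finrank K (restrictSupport K s) = s.ncard := by
  rw [Module.finrank_eq_nat_card_basis (basisRestrictSupport K s)]
  rfl

lemma homogeneousSubmodule_eq_restrictSupport (t : ℕ) :
    homogeneousSubmodule (Fin (n + 1)) K t = restrictSupport K {m | m.degree = t} :=
  homogeneousSubmodule_eq_finsupp_supported _ _ _

instance finiteDimensional_homogeneousSubmodule (t : ℕ) :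
    FiniteDimensional K (homogeneousSubmodule (Fin (n + 1)) K t) :=
  Module.Finite.iff_fg.2 (homogeneousSubmodule_fg _ _ t)

/-- The vector space `I_t` of forms of degree `t` in the ideal `I`. -/
noncomputable def idealPart (I : Ideal (PolyRing K n)) (t : ℕ) : Submodule K (PolyRing K n) :=
  homogeneousSubmodule (Fin (n + 1)) K t ⊓ I.restrictScalars K

lemma mem_idealPart {I : Ideal (PolyRing K n)} {t : ℕ} {f : PolyRing K n} :
    f ∈ idealPart I t ↔ f.IsHomogeneous t ∧ f ∈ I := Iff.rfl

instance finiteDimensional_idealPart (I : Ideal (PolyRing K n)) (t : ℕ) :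
    FiniteDimensional K (idealPart I t) :=
  Submodule.finiteDimensional_of_le (inf_le_left : _ ≤ homogeneousSubmodule (Fin (n + 1)) K t)

/-- The generating function of `t ↦ dim I_t`. -/
noncomputable def idealSeries (I : Ideal (PolyRing K n)) : PowerSeries ℤ :=
  PowerSeries.mk fun t => (Module.finrank K (idealPart I t) : ℤ)

/-- The Hilbert series of `R/I`. -/
noncomputable def quotSeries (I : Ideal (PolyRing K n)) : PowerSeries ℤ :=
  PowerSeries.mk fun t => (hilbertFunction I t : ℤ)

lemma finrank_map_add_finrank_inf_ker {V W : Type*} [AddCommGroup V] [Module K V] [AddCommGroup W]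
    [Module K W] (f : V →ₗ[K] W) (p : Submodule K V) [FiniteDimensional K p] :
    Module.finrank K (p.map f) + Module.finrank K (p ⊓ LinearMap.ker f : Submodule K V) =
      Module.finrank K p := by
  have h := LinearMap.finrank_range_add_finrank_ker (f.domRestrict p)
  rw [LinearMap.range_domRestrict, LinearMap.ker_domRestrict] at h
  have hc : (LinearMap.ker f).comap p.subtype = (p ⊓ LinearMap.ker f).comap p.subtype := by
    ext x; simp
  rw [← h, hc, (Submodule.comapSubtypeEquivOfLe (inf_le_left : p ⊓ LinearMap.ker f ≤ p)).finrank_eq]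

lemma hilbertFunction_add_finrank (I : Ideal (PolyRing K n)) (t : ℕ) :
    hilbertFunction I t + Module.finrank K (idealPart I t) =
      Module.finrank K (homogeneousSubmodule (Fin (n + 1)) K t) := by
  have hker : I.restrictScalars K = LinearMap.ker (Ideal.Quotient.mkₐ K I).toLinearMap := by
    ext f
    simp [Ideal.Quotient.eq_zero_iff_mem]
  rw [idealPart, hker, hilbertFunction, finrank_map_add_finrank_inf_ker]

lemma idealPart_top (t : ℕ) :
    idealPart (⊤ : Ideal (PolyRing K n)) t = homogeneousSubmodule (Fin (n + 1)) K t := by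
  ext f; simp [mem_idealPart]

lemma quotSeries_add_idealSeries (I : Ideal (PolyRing K n)) :
    quotSeries I + idealSeries I = idealSeries (⊤ : Ideal (PolyRing K n)) := by
  ext t
  simp only [quotSeries, idealSeries, map_add, PowerSeries.coeff_mk]
  rw [idealPart_top]
  exact_mod_cast hilbertFunction_add_finrank I t

lemma idealSeries_top_eq_countSeries :
    idealSeries (⊤ : Ideal (PolyRing K n)) = countSeries (n := n) Set.univ := by
  ext t
  simp only [idealSeries, countSeries, PowerSeries.coeff_mk]
  rw [idealPart_top, homogeneousSubmodule_eq_restrictSupport, finrank_restrictSupport,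
    Set.univ_inter]

lemma idealSeries_top :
    idealSeries (⊤ : Ideal (PolyRing K n)) * (1 - PowerSeries.X) ^ (n + 1) = 1 := by
  rw [idealSeries_top_eq_countSeries, countSeries_univ]

/-- The Hilbert series of `R` modulo a monomial ideal counts the monomials outside the ideal. -/
lemma quotSeries_restrictSupportIdeal {s : Set (Fin (n + 1) →₀ ℕ)} (hs : IsUpperSet s) :
    quotSeries (restrictSupportIdeal (R := K) s hs) = countSeries sᶜ := by
  have h := quotSeries_add_idealSeries (restrictSupportIdeal (R := K) s hs)
  rw [idealSeries_top_eq_countSeries] at h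
  rw [eq_sub_of_add_eq h]
  ext t
  have hpart : idealPart (restrictSupportIdeal (R := K) s hs) t =
      restrictSupport K (s ∩ {m | m.degree = t}) := by
    ext f
    rw [mem_idealPart, mem_restrictSupport_iff, Set.subset_inter_iff, and_comm]
    refine and_congr Iff.rfl ?_
    rw [← mem_homogeneousSubmodule, homogeneousSubmodule_eq_restrictSupport,
      mem_restrictSupport_iff]
  simp only [map_sub, idealSeries, countSeries, PowerSeries.coeff_mk]
  rw [hpart, finrank_restrictSupport, sub_eq_iff_eq_add, ← Nat.cast_add,
    ← Set.ncard_union_eq ?_ (finite_inter_degree _ _) (finite_inter_degree _ _), ← Set.union_inter_distrib_right, Set.compl_union_self]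
  exact (disjoint_compl_left).mono Set.inter_subset_left Set.inter_subset_left

lemma one_sub_X_ne_zero : (1 - PowerSeries.X : PowerSeries ℤ) ≠ 0 := fun h => by
  simpa using congrArg PowerSeries.constantCoeff h

/-! ### Graded free modules -/

/-- The part of degree `t` of the graded free module `⨁_k R(-c k)`. -/
noncomputable def strand {a : ℕ} (c : Fin a → ℕ) (t : ℕ) : Submodule K (Fin a → PolyRing K n) :=
  Submodule.pi Set.univ fun k => restrictSupport K {m | m.degree + c k = t}

lemma mem_strand {a : ℕ} {c : Fin a → ℕ} {t : ℕ} {v : Fin a → PolyRing K n} :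
    v ∈ strand c t ↔ ∀ k, ∀ m, coeff m (v k) ≠ 0 → m.degree + c k = t := by
  simp only [strand, Submodule.mem_pi, Set.mem_univ, true_implies, mem_restrictSupport_iff]
  refine forall_congr' fun k => ?_
  simp [Set.subset_def]

/-- The component of degree `t` of an element of `R(-c)`. -/
noncomputable def shiftComponent (c t : ℕ) (f : PolyRing K n) : PolyRing K n :=
  if c ≤ t then homogeneousComponent (t - c) f else 0

lemma coeff_shiftComponent (c t : ℕ) (f : PolyRing K n) (m : Fin (n + 1) →₀ ℕ) :
    coeff m (shiftComponent c t f) = if m.degree + c = t then coeff m f else 0 := by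
  rw [shiftComponent]
  split_ifs with h1 h2 h2
  · rw [coeff_homogeneousComponent, if_pos (by omega)]
  · rw [coeff_homogeneousComponent, if_neg (by omega)]
  · omega
  · rfl

/-- The component of degree `t` of an element of `⨁_k R(-c k)`. -/
noncomputable def vecComponent {a : ℕ} (c : Fin a → ℕ) (t : ℕ) (v : Fin a → PolyRing K n) :
    Fin a → PolyRing K n := fun k => shiftComponent (c k) t (v k)

lemma vecComponent_mem_strand {a : ℕ} (c : Fin a → ℕ) (t : ℕ) (v : Fin a → PolyRing K n) :
    vecComponent c t v ∈ strand c t := by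
  rw [mem_strand]
  intro k m hm
  rw [vecComponent, coeff_shiftComponent] at hm
  by_contra h
  exact hm (if_neg h)

lemma vecComponent_eq_self_iff {a : ℕ} {c : Fin a → ℕ} {t : ℕ} {v : Fin a → PolyRing K n} :
    vecComponent c t v = v ↔ v ∈ strand c t := by
  constructor
  · intro h; rw [← h]; exact vecComponent_mem_strand c t v
  · intro h
    rw [mem_strand] at h
    funext k
    ext m
    rw [vecComponent, coeff_shiftComponent]
    split_ifs with hm
    · rfl
    · by_contra h'
      exact hm (h k m (Ne.symm h'))

/-- Every vector is the sum of its components. -/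
lemma exists_sum_vecComponent {a : ℕ} (c : Fin a → ℕ) (v : Fin a → PolyRing K n) :
    ∃ N, v = ∑ t ∈ Finset.range N, vecComponent c t v := by
  refine ⟨(Finset.univ.sup fun k => (v k).totalDegree + c k) + 1, ?_⟩
  funext k
  ext m
  rw [Finset.sum_apply, coeff_sum]
  simp only [vecComponent, coeff_shiftComponent]
  rw [Finset.sum_ite_eq]
  split_ifs with h
  · rfl
  · by_contra hm
    apply h
    have h1 : m.degree ≤ (v k).totalDegree :=
      le_totalDegree (mem_support_iff.2 hm)
    have h2 := Finset.le_sup (f := fun k => (v k).totalDegree + c k) (Finset.mem_univ k)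
    simp only [Finset.mem_range]
    omega

/-- A matrix defines a homogeneous map `⨁_j R(-c' j) → ⨁_i R(-c i)` of degree zero. -/
def IsGradedMatrix {a b : ℕ} (c : Fin a → ℕ) (c' : Fin b → ℕ)
    (D : Matrix (Fin a) (Fin b) (PolyRing K n)) : Prop :=
  ∀ i j, ∀ m ∈ (D i j).support, m.degree + c i = c' j

lemma IsGradedMatrix.vecComponent_mulVec {a b : ℕ} {c : Fin a → ℕ} {c' : Fin b → ℕ}
    {D : Matrix (Fin a) (Fin b) (PolyRing K n)} (hD : IsGradedMatrix c c' D) (t : ℕ)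
    (v : Fin b → PolyRing K n) :
    vecComponent c t (D.mulVec v) = D.mulVec (vecComponent c' t v) := by
  funext i
  ext m
  simp only [vecComponent, coeff_shiftComponent, Matrix.mulVec, dotProduct, coeff_sum, coeff_mul]
  have key : ∀ x, ∀ p ∈ Finset.HasAntidiagonal.antidiagonal m,
      coeff p.1 (D i x) * (if p.2.degree + c' x = t then coeff p.2 (v x) else 0) =
        if m.degree + c i = t then coeff p.1 (D i x) * coeff p.2 (v x) else 0 := by
    intro x p hp
    rw [Finset.HasAntidiagonal.mem_antidiagonal] at hp
    by_cases h0 : coeff p.1 (D i x) = 0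
    · simp [h0]
    · have h1 := hD i x p.1 (mem_support_iff.2 h0)
      have h2 : m.degree = p.1.degree + p.2.degree := by rw [← hp, map_add]
      have h3 : p.2.degree + c' x = t ↔ m.degree + c i = t := by omega
      simp only [h3, mul_ite, mul_zero]
  rw [Finset.sum_congr rfl fun x _ => Finset.sum_congr rfl (key x)]
  split_ifs <;> simp

lemma IsGradedMatrix.mulVec_mem_strand {a b : ℕ} {c : Fin a → ℕ} {c' : Fin b → ℕ}
    {D : Matrix (Fin a) (Fin b) (PolyRing K n)} (hD : IsGradedMatrix c c' D) {t : ℕ}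
    {v : Fin b → PolyRing K n} (hv : v ∈ strand c' t) : D.mulVec v ∈ strand c t := by
  rw [← vecComponent_eq_self_iff, hD.vecComponent_mulVec, vecComponent_eq_self_iff.2 hv]

/-- The underlying `K`-linear map of a matrix over `R`. -/
noncomputable def matrixMap {a b : ℕ} (D : Matrix (Fin a) (Fin b) (PolyRing K n)) :
    (Fin b → PolyRing K n) →ₗ[K] (Fin a → PolyRing K n) :=
  D.mulVecLin.restrictScalars K

@[simp]
lemma matrixMap_apply {a b : ℕ} (D : Matrix (Fin a) (Fin b) (PolyRing K n))
    (v : Fin b → PolyRing K n) : matrixMap D v = D.mulVec v := rfl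

/-- An exact sequence of homogeneous maps of degree zero is exact in each degree. -/
lemma strand_inf_ker_eq_map {a b e : ℕ} {c : Fin b → ℕ} {c' : Fin e → ℕ}
    {D : Matrix (Fin a) (Fin b) (PolyRing K n)} {D' : Matrix (Fin b) (Fin e) (PolyRing K n)}
    (hD' : IsGradedMatrix c c' D')
    (hex : LinearMap.ker D.mulVecLin = LinearMap.range D'.mulVecLin) (t : ℕ) :
    strand c t ⊓ LinearMap.ker (matrixMap D) = (strand c' t).map (matrixMap D') := by
  ext v
  rw [Submodule.mem_inf, Submodule.mem_map]
  have hker : v ∈ LinearMap.ker (matrixMap D) ↔ v ∈ LinearMap.range D'.mulVecLin := by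
    rw [← hex]; rfl
  rw [hker]
  constructor
  · rintro ⟨hv, w, rfl⟩
    refine ⟨vecComponent c' t w, vecComponent_mem_strand _ _ _, ?_⟩
    rw [matrixMap_apply, ← hD'.vecComponent_mulVec]
    exact vecComponent_eq_self_iff.2 hv
  · rintro ⟨w, hw, rfl⟩
    exact ⟨hD'.mulVec_mem_strand hw, w, rfl⟩

/-- The graded pieces of a free module, as products of spaces of forms. -/
noncomputable def strandEquiv {a : ℕ} (c : Fin a → ℕ) (t : ℕ) :
    strand (K := K) (n := n) c t ≃ₗ[K]
      ((k : Fin a) → restrictSupport K {m : Fin (n + 1) →₀ ℕ | m.degree + c k = t}) where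
  toFun v k := ⟨v.1 k, v.2 k trivial⟩
  invFun w := ⟨fun k => (w k).1, fun k _ => (w k).2⟩
  map_add' _ _ := rfl
  map_smul' _ _ := rfl
  left_inv _ := rfl
  right_inv _ := rfl

lemma finite_degree_add_eq (c t : ℕ) : {m : Fin (n + 1) →₀ ℕ | m.degree + c = t}.Finite :=
  (Finsupp.finite_of_degree_le t).subset fun m (hm : m.degree + c = t) => by
    simp only [Set.mem_ofPred_eq]; omega

instance finiteDimensional_restrictSupport (c t : ℕ) :
    FiniteDimensional K (restrictSupport K {m : Fin (n + 1) →₀ ℕ | m.degree + c = t}) := by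
  have := (finite_degree_add_eq (n := n) c t).to_subtype
  exact Module.Finite.of_basis (basisRestrictSupport K _)

instance finiteDimensional_strand {a : ℕ} (c : Fin a → ℕ) (t : ℕ) :
    FiniteDimensional K (strand (K := K) (n := n) c t) :=
  Module.Finite.equiv (strandEquiv c t).symm

lemma ncard_degree_add_eq (c t : ℕ) : ({m : Fin (n + 1) →₀ ℕ | m.degree + c = t}.ncard : ℤ) =
    PowerSeries.coeff t (PowerSeries.X ^ c * countSeries (n := n) Set.univ) := by
  rw [PowerSeries.coeff_X_pow_mul']
  split_ifs with h
  · rw [countSeries, PowerSeries.coeff_mk, Set.univ_inter]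
    congr 2
    ext m
    simp only [Set.mem_ofPred_eq]
    omega
  · have : {m : Fin (n + 1) →₀ ℕ | m.degree + c = t} = ∅ := by
      ext m
      simp only [Set.mem_ofPred_eq, Set.mem_empty_iff_false, iff_false]
      omega
    simp [this]

lemma finrank_strand {a : ℕ} (c : Fin a → ℕ) (t : ℕ) :
    (Module.finrank K (strand (K := K) (n := n) c t) : ℤ) =
      PowerSeries.coeff t ((∑ k, PowerSeries.X ^ c k) * countSeries (n := n) Set.univ) := by
  rw [(strandEquiv c t).finrank_eq, Module.finrank_pi_fintype, Finset.sum_mul, map_sum,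
    Nat.cast_sum]
  refine Finset.sum_congr rfl fun k _ => ?_
  rw [finrank_restrictSupport, ncard_degree_add_eq]

/-! ### The Hilbert series from a resolution -/

/-- The polynomial `∑ T^q`, the sum over a multiset of degrees `q`. -/
noncomputable def shiftPoly (s : Multiset ℕ) : Polynomial ℤ := (s.map fun q => Polynomial.X ^ q).sum

lemma shiftPoly_zero : shiftPoly 0 = 0 := rfl

lemma shiftPoly_cons (a : ℕ) (s : Multiset ℕ) :
    shiftPoly (a ::ₘ s) = Polynomial.X ^ a + shiftPoly s := by
  simp [shiftPoly]

lemma shiftPoly_add (s t : Multiset ℕ) : shiftPoly (s + t) = shiftPoly s + shiftPoly t := by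
  simp [shiftPoly]

lemma shiftPoly_sum {ι : Type*} (s : Finset ι) (f : ι → Multiset ℕ) :
    shiftPoly (∑ i ∈ s, f i) = ∑ i ∈ s, shiftPoly (f i) := by
  classical
  induction s using Finset.induction_on with
  | empty => simp [shiftPoly_zero]
  | insert i s hi ih => rw [Finset.sum_insert hi, Finset.sum_insert hi, shiftPoly_add, ih]

lemma coeff_shiftPoly (s : Multiset ℕ) (t : ℕ) : (shiftPoly s).coeff t = s.count t := by
  induction s using Multiset.induction_on with
  | empty => simp [shiftPoly_zero]
  | cons a s ih =>
    rw [shiftPoly_cons, Polynomial.coeff_add, Polynomial.coeff_X_pow, ih, Multiset.count_cons]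
    push_cast
    ring

namespace MinimalFreeResolution

variable {I : Ideal (PolyRing K n)} (ρ : MinimalFreeResolution I)

lemma coe_shiftPoly_shifts (p : ℕ) :
    (shiftPoly (ρ.shifts p) : PowerSeries ℤ) = ∑ k, PowerSeries.X ^ ρ.shift p k := by
  rw [shiftPoly, shifts, Multiset.map_map, ← Finset.sum]
  rw [← Polynomial.coeToPowerSeries.ringHom_apply, map_sum]
  simp

lemma isGradedMatrix_d (p : ℕ) : IsGradedMatrix (ρ.shift p) (ρ.shift (p + 1)) (ρ.d p) :=
  ρ.d_homogeneous p

/-- The row of generators, as a matrix. -/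
def genMatrix : Matrix (Fin 1) (Fin (ρ.rank 0)) (PolyRing K n) := Matrix.of fun _ k => ρ.gen k

lemma isGradedMatrix_genMatrix : IsGradedMatrix (fun _ => 0) (ρ.shift 0) ρ.genMatrix := by
  intro i j m hm
  rw [add_zero]
  by_contra h
  exact mem_support_iff.1 hm ((ρ.gen_homogeneous j).coeff_eq_zero h)

lemma genMatrix_mulVec (v : Fin (ρ.rank 0) → PolyRing K n) :
    ρ.genMatrix.mulVec v = fun _ => Fintype.linearCombination (PolyRing K n) ρ.gen v := by
  funext i
  simp [genMatrix, Matrix.mulVec, dotProduct, Fintype.linearCombination_apply, mul_comm]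

lemma ker_genMatrix :
    LinearMap.ker ρ.genMatrix.mulVecLin = LinearMap.range (ρ.d 0).mulVecLin := by
  rw [← ρ.exact_gen]
  ext v
  rw [LinearMap.mem_ker, LinearMap.mem_ker, Matrix.mulVecLin_apply, genMatrix_mulVec]
  constructor
  · intro h; exact congrFun h 0
  · intro h; funext i; exact h

lemma finrank_map_genMatrix (t : ℕ) :
    Module.finrank K ((strand (ρ.shift 0) t).map (matrixMap ρ.genMatrix)) =
      Module.finrank K (idealPart I t) := by
  let π : (Fin 1 → PolyRing K n) ≃ₗ[K] PolyRing K n := LinearEquiv.funUnique (Fin 1) K _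
  rw [← LinearEquiv.finrank_map_eq π]
  suffices h : ((strand (ρ.shift 0) t).map (matrixMap ρ.genMatrix)).map (π : _ →ₗ[K] _) =
      idealPart I t by rw [h]
  ext f
  simp only [Submodule.mem_map, mem_idealPart]
  constructor
  · rintro ⟨_, ⟨v, hv, rfl⟩, rfl⟩
    have h := ρ.isGradedMatrix_genMatrix.mulVec_mem_strand hv
    constructor
    · intro m hm
      have := mem_strand.1 h 0 m hm
      rw [← this, add_zero, Finsupp.degree_eq_weight_one]
      rfl
    · change ρ.genMatrix.mulVec v 0 ∈ I
      rw [genMatrix_mulVec]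
      exact ρ.span_gen.le ((Submodule.mem_span_range_iff_exists_fun _).2 ⟨v, rfl⟩)
  · rintro ⟨hf, hfI⟩
    obtain ⟨v, hv⟩ := (Submodule.mem_span_range_iff_exists_fun _).1 (ρ.span_gen.ge hfI)
    have hG : ρ.genMatrix.mulVec v = fun _ => f := by
      rw [genMatrix_mulVec, ← hv]; rfl
    refine ⟨fun _ => f, ⟨vecComponent (ρ.shift 0) t v, vecComponent_mem_strand _ _ _, ?_⟩, rfl⟩
    rw [matrixMap_apply, ← ρ.isGradedMatrix_genMatrix.vecComponent_mulVec, hG,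
      vecComponent_eq_self_iff, mem_strand]
    intro _ m hm
    by_contra h
    exact hm (hf.coeff_eq_zero h)

/-- The alternating sum of the dimensions in degree `t`, truncated after `N + 1` steps. -/
lemma finrank_idealPart_eq_sum (t N : ℕ) : (Module.finrank K (idealPart I t) : ℤ) =
    ∑ p ∈ Finset.range (N + 1),
        (-1) ^ p * (Module.finrank K (strand (K := K) (n := n) (ρ.shift p) t) : ℤ) -
      (-1) ^ N * Module.finrank K ((strand (ρ.shift (N + 1)) t).map (matrixMap (ρ.d N))) := by
  induction N with
  | zero =>
    have h := finrank_map_add_finrank_inf_ker (matrixMap ρ.genMatrix) (strand (ρ.shift 0) t)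
    rw [finrank_map_genMatrix, strand_inf_ker_eq_map (ρ.isGradedMatrix_d 0) ρ.ker_genMatrix] at h
    simp only [zero_add, Finset.sum_range_one, pow_zero, one_mul]
    rw [← h]
    push_cast
    ring
  | succ N ih =>
    have h := finrank_map_add_finrank_inf_ker (matrixMap (ρ.d N)) (strand (ρ.shift (N + 1)) t)
    rw [strand_inf_ker_eq_map (ρ.isGradedMatrix_d (N + 1)) (ρ.exact_d N)] at h
    rw [ih, Finset.sum_range_succ _ (N + 1), ← h]
    push_cast
    ring

/-- The numerator `1 - ∑ T^r + ∑ T^s` of the Hilbert series of `R/I` read off a resolution. -/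
noncomputable def numerator : Polynomial ℤ :=
  1 - shiftPoly ρ.oddShifts + shiftPoly ρ.evenShifts

lemma sum_neg_one_pow_mul_shiftPoly :
    ∑ p ∈ Finset.range (n + 1), (-1) ^ p * shiftPoly (ρ.shifts p) = 1 - ρ.numerator := by
  rw [numerator, oddShifts, evenShifts, shiftPoly_sum, shiftPoly_sum, Finset.sum_filter,
    Finset.sum_filter]
  rw [sub_add, sub_sub_cancel, ← Finset.sum_sub_distrib]
  refine Finset.sum_congr rfl fun p _ => ?_
  rcases Nat.even_or_odd p with h | h
  · rw [if_pos h.add_one, if_neg (by simpa using h.add_one), h.neg_one_pow]; ring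
  · rw [if_neg (by simpa using h.add_one), if_pos h.add_one, h.neg_one_pow]; ring

lemma idealSeries_mul : idealSeries I * (1 - PowerSeries.X) ^ (n + 1) =
    ((1 - ρ.numerator : Polynomial ℤ) : PowerSeries ℤ) := by
  have h : idealSeries I =
      ((1 - ρ.numerator : Polynomial ℤ) : PowerSeries ℤ) * countSeries (n := n) Set.univ := by
    ext t
    rw [idealSeries, PowerSeries.coeff_mk, ρ.finrank_idealPart_eq_sum t n,
      ← sum_neg_one_pow_mul_shiftPoly, ← Polynomial.coeToPowerSeries.ringHom_apply, map_sum,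
      Finset.sum_mul, map_sum]
    have hzero : strand (K := K) (n := n) (ρ.shift (n + 1)) t = ⊥ := by
      have := ρ.length_le (n + 1) le_rfl
      have : IsEmpty (Fin (ρ.rank (n + 1))) := by rw [this]; infer_instance
      exact Subsingleton.elim _ _
    rw [hzero, Submodule.map_bot, finrank_bot]
    simp only [Nat.cast_zero, mul_zero, sub_zero]
    refine Finset.sum_congr rfl fun p _ => ?_
    rw [finrank_strand, ← coe_shiftPoly_shifts]
    rcases Nat.even_or_odd p with h | h
    · rw [h.neg_one_pow, h.neg_one_pow, one_mul, one_mul,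
        Polynomial.coeToPowerSeries.ringHom_apply]
    · rw [h.neg_one_pow, h.neg_one_pow, neg_one_mul, neg_one_mul, map_neg, neg_mul, map_neg,
        Polynomial.coeToPowerSeries.ringHom_apply]
  rw [h, mul_assoc, countSeries_univ, mul_one]

lemma quotSeries_mul : quotSeries I * (1 - PowerSeries.X) ^ (n + 1) =
    (ρ.numerator : PowerSeries ℤ) := by
  rw [eq_sub_of_add_eq (quotSeries_add_idealSeries I), sub_mul, idealSeries_top,
    ρ.idealSeries_mul]
  simp

end MinimalFreeResolution

/-! ### Hilbert's syzygy theorem -/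

/-- Setting the first variable to zero. -/
noncomputable def killFirst (K : Type*) [Field K] (m : ℕ) :
    MvPolynomial (Fin (m + 1)) K →ₐ[K] MvPolynomial (Fin m) K :=
  aeval (Fin.cases 0 X)

lemma killFirst_X_zero (m : ℕ) : killFirst K m (X 0) = 0 := by
  rw [killFirst, aeval_X]; rfl

lemma killFirst_X_succ (m : ℕ) (j : Fin m) : killFirst K m (X j.succ) = X j := by
  rw [killFirst, aeval_X]; rfl

lemma killFirst_rename (m : ℕ) (f : MvPolynomial (Fin m) K) :
    killFirst K m (rename Fin.succ f) = f := by
  have : (killFirst K m).comp (rename Fin.succ) = AlgHom.id K _ := by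
    ext i; simp [killFirst]
  exact DFunLike.congr_fun this f

lemma exists_killFirst_comp_eq {a m : ℕ} (w : Fin a → MvPolynomial (Fin m) K) :
    ∃ v : Fin a → MvPolynomial (Fin (m + 1)) K, killFirst K m ∘ v = w := by
  refine ⟨fun i => rename Fin.succ (w i), ?_⟩
  funext i
  rw [Function.comp_apply, killFirst_rename]

lemma constantCoeff_killFirst (m : ℕ) (f : MvPolynomial (Fin (m + 1)) K) :
    constantCoeff (killFirst K m f) = constantCoeff f := by
  have : ((aeval fun _ => (0 : K)) : MvPolynomial (Fin m) K →ₐ[K] K).comp (killFirst K m) =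
      aeval fun _ => (0 : K) := by
    ext i
    refine Fin.cases ?_ (fun i => ?_) i <;> simp [killFirst]
  have h := DFunLike.congr_fun this f
  simpa using h

lemma exists_eq_X_mul_of_killFirst_eq_zero {m : ℕ} {f : MvPolynomial (Fin (m + 1)) K}
    (hf : killFirst K m f = 0) : ∃ g, f = X 0 * g := by
  let q := Ideal.Quotient.mkₐ K (Ideal.span {(X 0 : MvPolynomial (Fin (m + 1)) K)})
  have : (q.comp (rename Fin.succ)).comp (killFirst K m) = q := by
    ext i
    refine Fin.cases ?_ (fun i => ?_) i
    · simp [killFirst, q]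
    · simp [killFirst, q]
  have h := DFunLike.congr_fun this f
  rw [AlgHom.comp_apply, hf, map_zero] at h
  exact Ideal.mem_span_singleton.1 (Ideal.Quotient.eq_zero_iff_mem.1 h.symm)

/-- A minimal exact complex `F_0 ← F_1 ← ⋯` of free modules over a polynomial ring in `m` variables
has `F_p = 0` for `p > m`. Reducing modulo a variable, which is a nonzerodivisor, keeps the
complex minimal and exact from `F_2` on. -/
theorem rank_eq_zero_of_exact_of_minimal (m : ℕ) : ∀ (rank : ℕ → ℕ)
    (d : (p : ℕ) → Matrix (Fin (rank p)) (Fin (rank (p + 1))) (MvPolynomial (Fin m) K)),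
    (∀ p i j, constantCoeff (d p i j) = 0) →
    (∀ p, LinearMap.ker (d p).mulVecLin = LinearMap.range (d (p + 1)).mulVecLin) →
    ∀ p, m + 1 ≤ p → rank p = 0 := by
  induction m with
  | zero =>
    intro rank d hmin hex p hp
    obtain ⟨q, rfl⟩ : ∃ q, p = q + 1 := ⟨p - 1, by omega⟩
    have hd : ∀ p, d p = 0 := by
      intro p
      ext1 i j
      rw [eq_C_of_isEmpty (d p i j)]
      have := hmin p i j
      rw [constantCoeff_eq] at this
      rw [this, C_0]
      rfl
    have h := hex q
    rw [hd, hd, Matrix.mulVecLin_zero, Matrix.mulVecLin_zero, LinearMap.ker_zero,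
      LinearMap.range_zero] at h
    by_contra h0
    have : Nonempty (Fin (rank (q + 1))) := ⟨⟨0, Nat.pos_of_ne_zero h0⟩⟩
    exact top_ne_bot h
  | succ m ih =>
    intro rank d hmin hex p hp
    obtain ⟨q, rfl⟩ : ∃ q, p = q + 1 := ⟨p - 1, by omega⟩
    refine ih (fun p => rank (p + 1)) (fun p => (d (p + 1)).map (killFirst K m))
      (fun p i j => ?_) (fun p => ?_) q (by omega)
    · rw [Matrix.map_apply, constantCoeff_killFirst, hmin]
    · have hmap : ∀ (p) (v : Fin (rank (p + 1)) → MvPolynomial (Fin (m + 1)) K),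
          ((d p).map (killFirst K m)).mulVec (killFirst K m ∘ v) =
            killFirst K m ∘ (d p).mulVec v := fun p v => by
        funext i
        simp [Matrix.mulVec, dotProduct]
      ext w
      rw [LinearMap.mem_ker, LinearMap.mem_range]
      constructor
      · intro hw
        obtain ⟨v, rfl⟩ := exists_killFirst_comp_eq w
        rw [Matrix.mulVecLin_apply, hmap] at hw
        have : ∀ i, ∃ g, (d (p + 1)).mulVec v i = X 0 * g := fun i =>
          exists_eq_X_mul_of_killFirst_eq_zero (congrFun hw i)
        choose u hu using this
        have hu' : (d (p + 1)).mulVec v = (X 0 : MvPolynomial (Fin (m + 1)) K) • u := by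
          funext i
          rw [hu i, Pi.smul_apply, smul_eq_mul]
        have hu0 : u ∈ LinearMap.ker (d p).mulVecLin := by
          have h1 : (d p).mulVecLin ((X 0 : MvPolynomial (Fin (m + 1)) K) • u) = 0 := by
            rw [← hu', ← LinearMap.mem_ker, hex p]
            exact ⟨v, rfl⟩
          rw [map_smul] at h1
          funext i
          exact (mul_eq_zero.1 (congrFun h1 i)).resolve_left (X_ne_zero 0)
        obtain ⟨z, hz⟩ := (hex p).le hu0
        have h2 : v - (X 0 : MvPolynomial (Fin (m + 1)) K) • z ∈
            LinearMap.ker (d (p + 1)).mulVecLin := by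
          rw [LinearMap.mem_ker, map_sub, map_smul, hz, Matrix.mulVecLin_apply, hu', sub_self]
        rw [hex (p + 1)] at h2
        obtain ⟨y, hy⟩ := h2
        refine ⟨killFirst K m ∘ y, ?_⟩
        rw [Matrix.mulVecLin_apply, hmap]
        rw [Matrix.mulVecLin_apply] at hy
        rw [hy]
        funext i
        simp [killFirst]
      · rintro ⟨y, rfl⟩
        obtain ⟨x, rfl⟩ := exists_killFirst_comp_eq y
        have h1 : (d (p + 2)).mulVec x ∈ LinearMap.ker (d (p + 1)).mulVecLin := by
          rw [hex (p + 1)]; exact ⟨x, rfl⟩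
        rw [LinearMap.mem_ker, Matrix.mulVecLin_apply] at h1
        rw [Matrix.mulVecLin_apply, Matrix.mulVecLin_apply, hmap, hmap, h1]
        funext i
        simp

/-! ### Existence of minimal free resolutions -/

/-- A graded submodule of a graded free module `⨁_k R(-shift k)`. -/
structure GradedSubmodule (K : Type*) [Field K] (n : ℕ) where
  rank : ℕ
  shift : Fin rank → ℕ
  carrier : Submodule (PolyRing K n) (Fin rank → PolyRing K n)
  vecComponent_mem : ∀ v ∈ carrier, ∀ t, vecComponent shift t v ∈ carrier

lemma IsGradedMatrix.col_mem_strand {a b : ℕ} {c : Fin a → ℕ} {c' : Fin b → ℕ}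
    {D : Matrix (Fin a) (Fin b) (PolyRing K n)} :
    IsGradedMatrix c c' D ↔ ∀ j, D.col j ∈ strand c (c' j) := by
  simp only [IsGradedMatrix, mem_strand, mem_support_iff, Matrix.col_apply]
  exact forall_comm

lemma GradedSubmodule.exists_isGradedMatrix (s : GradedSubmodule K n) :
    ∃ (b : ℕ) (c' : Fin b → ℕ) (D : Matrix (Fin s.rank) (Fin b) (PolyRing K n)),
      IsGradedMatrix s.shift c' D ∧ LinearMap.range D.mulVecLin = s.carrier := by
  let S : Set (Fin s.rank → PolyRing K n) := {v | v ∈ s.carrier ∧ ∃ t, v ∈ strand s.shift t}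
  have hS : Submodule.span (PolyRing K n) S = s.carrier := by
    apply le_antisymm
    · exact Submodule.span_le.2 fun v hv => hv.1
    · intro v hv
      obtain ⟨N, hN⟩ := exists_sum_vecComponent s.shift v
      rw [hN]
      exact Submodule.sum_mem _ fun t _ => Submodule.subset_span
        ⟨s.vecComponent_mem v hv t, t, vecComponent_mem_strand _ _ _⟩
  obtain ⟨T, hTS, hT⟩ := (Submodule.fg_span_iff_fg_span_finset_subset S).1
    (hS ▸ IsNoetherian.noetherian s.carrier)
  have hT' : ∀ j : Fin T.card, ∃ t, (T.equivFin.symm j).1 ∈ strand s.shift t := fun j =>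
    (hTS (T.equivFin.symm j).2).2
  choose c' hc' using hT'
  refine ⟨T.card, c', Matrix.of fun i j => (T.equivFin.symm j).1 i, ?_, ?_⟩
  · exact IsGradedMatrix.col_mem_strand.2 hc'
  · rw [Matrix.range_mulVecLin, ← hS, hT]
    congr 1
    ext v
    constructor
    · rintro ⟨j, rfl⟩
      exact (T.equivFin.symm j).2
    · intro hv
      refine ⟨T.equivFin ⟨v, hv⟩, ?_⟩
      funext i
      simp

/-- A graded submodule is the image of a homogeneous map of a free module whose kernel has no
vector with a unit entry; the columns form a shortest homogeneous generating set. -/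
lemma GradedSubmodule.exists_minimal_isGradedMatrix (s : GradedSubmodule K n) :
    ∃ (b : ℕ) (c' : Fin b → ℕ) (D : Matrix (Fin s.rank) (Fin b) (PolyRing K n)),
      IsGradedMatrix s.shift c' D ∧ LinearMap.range D.mulVecLin = s.carrier ∧
      ∀ v ∈ LinearMap.ker D.mulVecLin, ∀ j, constantCoeff (v j) = 0 := by
  classical
  have hex := s.exists_isGradedMatrix
  obtain ⟨c', D, hD, hrange⟩ := Nat.find_spec hex
  have hmin := fun b (hb : b < Nat.find hex) => Nat.find_min hex hb
  generalize Nat.find hex = b at c' D hD hrange hmin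
  refine ⟨b, c', D, hD, hrange, fun v hv j => ?_⟩
  by_contra hj
  obtain ⟨b, rfl⟩ : ∃ b', b = b' + 1 := ⟨b - 1, by have := j.2; omega⟩
  let w := vecComponent c' (c' j) v
  have hw : D.mulVec w = 0 := by
    have hv' : D.mulVec v = 0 := hv
    rw [← hD.vecComponent_mulVec, hv', vecComponent_eq_self_iff]
    exact zero_mem _
  have hwj : w j = C (constantCoeff (v j)) := by
    ext m
    rw [coeff_C, constantCoeff_eq]
    simp only [w, vecComponent, coeff_shiftComponent]
    by_cases hm : m = 0
    · subst hm; simp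
    · rw [if_neg (by simpa [Finsupp.degree_eq_zero_iff] using hm), if_neg (Ne.symm hm)]
  apply hmin b (Nat.lt_succ_self b)
  refine ⟨c' ∘ j.succAbove, D.submatrix id j.succAbove, fun i k => hD i _, ?_⟩
  rw [← hrange, Matrix.range_mulVecLin, Matrix.range_mulVecLin]
  apply le_antisymm
  · apply Submodule.span_mono
    rintro _ ⟨k, rfl⟩
    exact ⟨j.succAbove k, rfl⟩
  · rw [Submodule.span_le]
    rintro _ ⟨k, rfl⟩
    have hsucc : ∀ k, D.col (j.succAbove k) ∈ Submodule.span (PolyRing K n)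
        (Set.range (D.submatrix id j.succAbove).col) := fun k =>
      Submodule.subset_span ⟨k, rfl⟩
    rcases Fin.eq_self_or_eq_succAbove j k with rfl | ⟨k, rfl⟩
    · have hsum : (C (constantCoeff (v k)) : PolyRing K n) • D.col k +
          ∑ l, w (k.succAbove l) • D.col (k.succAbove l) = 0 := by
        rw [← hw, ← hwj, ← Fin.sum_univ_succAbove (fun l => w l • D.col l) k]
        funext i
        simp [Matrix.mulVec, dotProduct, mul_comm]
      have h1 : (C (constantCoeff (v k)) : PolyRing K n) • D.col k ∈ Submodule.span (PolyRing K n)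
          (Set.range (D.submatrix id k.succAbove).col) := by
        rw [eq_neg_of_add_eq_zero_left hsum]
        exact Submodule.neg_mem _ (Submodule.sum_mem _ fun l _ => Submodule.smul_mem _ _ (hsucc l))
      have h2 := Submodule.smul_mem _ (C (constantCoeff (v k))⁻¹ : PolyRing K n) h1
      rwa [smul_smul, ← C_mul, inv_mul_cancel₀ hj, C_1, one_smul] at h2
    · exact hsucc k

namespace GradedSubmodule

/-- The number of minimal generators. -/
noncomputable def numGens (s : GradedSubmodule K n) : ℕ := s.exists_minimal_isGradedMatrix.choose

/-- The degrees of the minimal generators. -/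
noncomputable def genShift (s : GradedSubmodule K n) : Fin s.numGens → ℕ :=
  s.exists_minimal_isGradedMatrix.choose_spec.choose

/-- The matrix whose columns are minimal generators. -/
noncomputable def genMatrix (s : GradedSubmodule K n) :
    Matrix (Fin s.rank) (Fin s.numGens) (PolyRing K n) :=
  s.exists_minimal_isGradedMatrix.choose_spec.choose_spec.choose

lemma isGradedMatrix_genMatrix (s : GradedSubmodule K n) :
    IsGradedMatrix s.shift s.genShift s.genMatrix :=
  s.exists_minimal_isGradedMatrix.choose_spec.choose_spec.choose_spec.1

lemma range_genMatrix (s : GradedSubmodule K n) :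
    LinearMap.range s.genMatrix.mulVecLin = s.carrier :=
  s.exists_minimal_isGradedMatrix.choose_spec.choose_spec.choose_spec.2.1

lemma constantCoeff_eq_zero_of_mem_ker (s : GradedSubmodule K n) :
    ∀ v ∈ LinearMap.ker s.genMatrix.mulVecLin, ∀ j, constantCoeff (v j) = 0 :=
  s.exists_minimal_isGradedMatrix.choose_spec.choose_spec.choose_spec.2.2

/-- The module of relations between the minimal generators. -/
noncomputable def syzygy (s : GradedSubmodule K n) : GradedSubmodule K n where
  rank := s.numGens
  shift := s.genShift
  carrier := LinearMap.ker s.genMatrix.mulVecLin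
  vecComponent_mem v hv t := by
    rw [LinearMap.mem_ker, Matrix.mulVecLin_apply] at hv ⊢
    rw [← s.isGradedMatrix_genMatrix.vecComponent_mulVec, hv, vecComponent_eq_self_iff]
    exact zero_mem _

/-- The iterated syzygy modules. -/
noncomputable def syzygies (s : GradedSubmodule K n) : ℕ → GradedSubmodule K n
  | 0 => s
  | p + 1 => (syzygies s p).syzygy

lemma col_mem_carrier (s : GradedSubmodule K n) (j : Fin s.numGens) :
    s.genMatrix.col j ∈ s.carrier := by
  rw [← s.range_genMatrix, Matrix.range_mulVecLin]
  exact Submodule.subset_span ⟨j, rfl⟩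

/-- A homogeneous ideal, as a graded submodule of the free module of rank one. -/
noncomputable def ofIdeal (I : Ideal (PolyRing K n)) (hI : IsHomogeneousIdeal I) :
    GradedSubmodule K n where
  rank := 1
  shift _ := 0
  carrier := Submodule.comap (LinearMap.proj 0) I
  vecComponent_mem v hv t := by
    simp only [Submodule.mem_comap, LinearMap.proj_apply, vecComponent, shiftComponent,
      Nat.zero_le, if_true] at hv ⊢
    exact homogeneousComponent_mem_of_mem hI hv _

end GradedSubmodule

lemma constantCoeff_eq_zero_of_mem {I : Ideal (PolyRing K n)} (hI : IsHomogeneousIdeal I)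
    (hproper : I ≠ ⊤) {f : PolyRing K n} (hf : f ∈ I) : constantCoeff f = 0 := by
  by_contra h
  apply hproper
  have h0 := homogeneousComponent_mem_of_mem hI hf 0
  rw [homogeneousComponent_zero] at h0
  exact Ideal.eq_top_of_isUnit_mem _ h0 ((isUnit_iff_ne_zero.2 h).map C)

theorem exists_minimalFreeResolution {I : Ideal (PolyRing K n)} (hI : IsHomogeneousIdeal I)
    (hproper : I ≠ ⊤) : Nonempty (MinimalFreeResolution I) := by
  let s := (GradedSubmodule.ofIdeal I hI).syzygies
  let d : (p : ℕ) → Matrix (Fin (s p).rank) (Fin (s (p + 1)).rank) (PolyRing K n) :=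
    fun p => (s p).genMatrix
  have hgr : ∀ p, IsGradedMatrix (s p).shift (s (p + 1)).shift (d p) := fun p =>
    (s p).isGradedMatrix_genMatrix
  have hex : ∀ p, LinearMap.ker (d p).mulVecLin = LinearMap.range (d (p + 1)).mulVecLin := fun p =>
    (s (p + 1)).range_genMatrix.symm
  have hmem : ∀ k, d 0 (0 : Fin 1) k ∈ I := fun k => (s 0).col_mem_carrier k
  have hmin0 : ∀ k, constantCoeff (d 0 (0 : Fin 1) k) = 0 := fun k =>
    constantCoeff_eq_zero_of_mem hI hproper (hmem k)
  have hmin : ∀ p i j, constantCoeff (d p i j) = 0 := by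
    intro p i j
    cases p with
    | zero => rw [Subsingleton.elim (α := Fin 1) i 0]; exact hmin0 j
    | succ p =>
      exact (s p).constantCoeff_eq_zero_of_mem_ker _ ((s (p + 1)).col_mem_carrier j) i
  have hmul : ∀ v, (d 0).mulVec v = fun _ : Fin 1 =>
      Fintype.linearCombination (PolyRing K n) (fun k => d 0 (0 : Fin 1) k) v := by
    intro v
    funext i
    rw [Subsingleton.elim (α := Fin 1) i 0]
    simp [Matrix.mulVec, dotProduct, Fintype.linearCombination_apply, mul_comm]
  exact ⟨{
    rank := fun p => (s (p + 1)).rank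
    shift := fun p => (s (p + 1)).shift
    gen := fun k => d 0 (0 : Fin 1) k
    d := fun p => d (p + 1)
    length_le := fun p hp => rank_eq_zero_of_exact_of_minimal (n + 1) (fun p => (s p).rank) d hmin
      hex (p + 1) (by omega)
    gen_homogeneous := fun k m hm => by
      have h := hgr 0 (0 : Fin 1) k m (mem_support_iff.2 hm)
      change m.degree + 0 = _ at h
      rw [← h, add_zero, Finsupp.degree_eq_weight_one]
      rfl
    d_homogeneous := fun p => hgr (p + 1)
    span_gen := by
      ext f
      rw [Ideal.span, Submodule.mem_span_range_iff_exists_fun]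
      have hr : ∀ v : Fin 1 → PolyRing K n, v ∈ LinearMap.range (d 0).mulVecLin ↔ v 0 ∈ I :=
        fun v => by
          change v ∈ LinearMap.range (s 0).genMatrix.mulVecLin ↔ v 0 ∈ I
          rw [(s 0).range_genMatrix]; rfl
      constructor
      · rintro ⟨v, hv⟩
        have h := (hr _).1 ⟨v, rfl⟩
        rw [Matrix.mulVecLin_apply, hmul] at h
        rwa [← hv]
      · intro hf
        obtain ⟨v, hv⟩ := (hr fun _ => f).2 hf
        rw [Matrix.mulVecLin_apply, hmul] at hv
        exact ⟨v, congrFun hv 0⟩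
    exact_gen := by
      rw [← hex 0]
      ext v
      rw [LinearMap.mem_ker, LinearMap.mem_ker, Matrix.mulVecLin_apply, hmul]
      exact ⟨fun h => funext fun _ => h, fun h => congrFun h 0⟩
    exact_d := fun p => hex (p + 1)
    gen_minimal := hmin0
    d_minimal := fun p => hmin (p + 1) }⟩

/-! ### Coprime forms and heights -/

/-- A prime of a factorial domain that contains two coprime elements has height at least two, by
the chain `0 < (p) < P` with `p` a prime factor in `P` of one of them. -/
lemma two_le_height_of_isPrime {R : Type*} [CommRing R] [IsDomain R] [UniqueFactorizationMonoid R]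
    {F G : R} (hF : F ≠ 0) (hFG : IsRelPrime F G) {P : Ideal R} [hP : P.IsPrime] (hFP : F ∈ P)
    (hGP : G ∈ P) : 2 ≤ P.height := by
  obtain ⟨f, hf, hfF⟩ := UniqueFactorizationMonoid.exists_prime_factors F hF
  have h1 : f.prod ∈ P := by
    obtain ⟨u, hu⟩ := hfF.symm
    rw [← hu]
    exact P.mul_mem_right _ hFP
  obtain ⟨p, hpf, hpP⟩ := (hP.multiset_prod_mem_iff_exists_mem f).1 h1
  have hp := hf p hpf
  have hprime : (Ideal.span {p}).IsPrime := (Ideal.span_singleton_prime hp.ne_zero).2 hp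
  have hlt1 : (⊥ : Ideal R) < Ideal.span {p} := by
    rw [bot_lt_iff_ne_bot, Ne, Ideal.span_singleton_eq_bot]
    exact hp.ne_zero
  have hlt2 : Ideal.span {p} < P := by
    refine lt_of_le_of_ne ((Ideal.span_singleton_le_iff_mem P).2 hpP) ?_
    rintro rfl
    exact hp.not_isUnit (hFG ((Multiset.dvd_prod hpf).trans hfF.dvd)
      (Ideal.mem_span_singleton.1 hGP))
  have h2 := Ideal.height_add_one_le_of_lt_of_isPrime hlt1
  have h3 := Ideal.height_add_one_le_of_lt_of_isPrime hlt2
  calc (2 : ℕ∞) = 0 + 1 + 1 := by norm_num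
    _ ≤ (⊥ : Ideal R).height + 1 + 1 := by gcongr; exact zero_le
    _ ≤ P.height := le_trans (by gcongr) h3

lemma le_height_of_forall_isPrime {R : Type*} [CommRing R] {I : Ideal R} {k : ℕ∞}
    (h : ∀ P : Ideal R, P.IsPrime → I ≤ P → k ≤ P.height) : k ≤ I.height := by
  rw [Ideal.height_eq_inf_minimalPrimes]
  exact le_iInf₂ fun P hP => h P hP.1.1 hP.1.2

/-- Krull's height theorem for two elements. -/
lemma height_span_pair_le_two {R : Type*} [CommRing R] [IsNoetherianRing R] {F G : R}
    (h : Ideal.span {F, G} ≠ ⊤) : (Ideal.span {F, G}).height ≤ 2 := by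
  refine (Ideal.height_le_spanFinrank _ h).trans ?_
  have h1 := Submodule.spanFinrank_span_le_ncard_of_finite (R := R) (s := {F, G})
    (Set.toFinite _)
  have h2 := Set.ncard_insert_le F {G}
  rw [Set.ncard_singleton] at h2
  exact_mod_cast h1.trans h2

lemma isRelPrime_of_forall_prime {R : Type*} [CommRing R] [IsDomain R]
    [UniqueFactorizationMonoid R] {F G : R} (hF : F ≠ 0) {f : Multiset R}
    (hf : ∀ p ∈ f, Prime p) (hfF : Associated f.prod F) (h : ∀ p ∈ f, ¬ p ∣ G) :
    IsRelPrime F G := by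
  refine WfDvdMonoid.isRelPrime_of_no_irreducible_factors (fun h0 => hF h0.1) fun z hz hzF hzG => ?_
  obtain ⟨p, hp, hzp⟩ := hz.prime.exists_mem_multiset_dvd (hzF.trans hfF.symm.dvd)
  exact h p hp (((hz.associated_of_dvd (hf p hp).irreducible hzp).symm.dvd).trans hzG)

/-- A prime does not divide all variables. -/
lemma exists_not_dvd_X (hn : 1 ≤ n) {p : PolyRing K n} (hp : Prime p) :
    ∃ i, ¬ p ∣ (X i : PolyRing K n) := by
  by_contra! h
  have h0 := (hp.irreducible.associated_of_dvd X_prime.irreducible (h 0)).symm.dvd.trans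
    (h (Fin.last n))
  have := X_dvd_X.1 h0
  simp only [Fin.ext_iff, Fin.val_zero, Fin.val_last] at this
  omega

/-- The elements of a subspace that are multiples of `p`. -/
noncomputable def multiplesIn (V : Submodule K (PolyRing K n)) (p : PolyRing K n) :
    Submodule K V :=
  ((Ideal.span {p}).restrictScalars K).comap V.subtype

lemma mem_multiplesIn {V : Submodule K (PolyRing K n)} {p : PolyRing K n} {v : V} :
    v ∈ multiplesIn V p ↔ p ∣ (v : PolyRing K n) :=
  Ideal.mem_span_singleton

/-- If no prime factor of `F` divides all elements of a subspace, then some element of the subspace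
is coprime to `F`, as a vector space over an infinite field is no finite union of proper
subspaces. -/
lemma exists_isRelPrime_mem [Infinite K] {F : PolyRing K n} (hF : F ≠ 0)
    (V : Submodule K (PolyRing K n))
    (hV : ∀ p, Prime p → p ∣ F → ∃ v ∈ V, ¬ p ∣ v) : ∃ v ∈ V, IsRelPrime F v := by
  classical
  obtain ⟨f, hf, hfF⟩ := UniqueFactorizationMonoid.exists_prime_factors F hF
  have htop : ⊤ ∉ f.toFinset.image (multiplesIn V) := by
    rw [Finset.mem_image]
    rintro ⟨p, hp, hpt⟩
    rw [Multiset.mem_toFinset] at hp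
    obtain ⟨v, hvV, hpv⟩ := hV p (hf p hp) ((Multiset.dvd_prod hp).trans hfF.dvd)
    have : (⟨v, hvV⟩ : V) ∈ multiplesIn V p := hpt ▸ Submodule.mem_top
    exact hpv (mem_multiplesIn.1 this)
  have hne := Subspace.biUnion_ne_univ_of_top_notMem htop
  rw [Set.ne_univ_iff_exists_notMem] at hne
  obtain ⟨v, hv⟩ := hne
  refine ⟨v, v.2, isRelPrime_of_forall_prime hF hf hfF fun p hp hpv => hv ?_⟩
  simp only [Set.mem_iUnion]
  exact ⟨_, Finset.mem_image_of_mem _ (Multiset.mem_toFinset.2 hp), mem_multiplesIn.2 hpv⟩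

lemma exists_form_not_mem {I J : Ideal (PolyRing K n)} (hI : IsHomogeneousIdeal I)
    (h : ¬ I ≤ J) : ∃ e, ∃ g ∈ idealPart I e, g ∉ J := by
  obtain ⟨f, hfI, hfJ⟩ := SetLike.not_le_iff_exists.1 h
  by_contra! hc
  apply hfJ
  rw [← sum_homogeneousComponent f]
  exact Submodule.sum_mem _ fun i _ => hc i _
    ⟨homogeneousComponent_isHomogeneous _ _, homogeneousComponent_mem_of_mem hI hfI _⟩

lemma one_le_of_two_le_height {I : Ideal (PolyRing K n)} (hproper : I ≠ ⊤) (h : 2 ≤ I.height) :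
    1 ≤ n := by
  have h1 := Ideal.height_le_ringKrullDim_of_ne_top hproper
  rw [MvPolynomial.ringKrullDim_of_isNoetherianRing, ringKrullDim_eq_zero_of_field] at h1
  have h2 : ((2 : ℕ∞) : WithBot ℕ∞) ≤ ((n + 1 : ℕ) : ℕ∞) := by
    refine (WithBot.coe_le_coe.2 h).trans (h1.trans ?_)
    simp
  have h3 : (2 : ℕ∞) ≤ ((n + 1 : ℕ) : ℕ∞) := WithBot.coe_le_coe.1 h2
  have h4 : 2 ≤ n + 1 := by exact_mod_cast h3
  omega

lemma ne_bot_of_two_le_height {I : Ideal (PolyRing K n)} (h : 2 ≤ I.height) : I ≠ ⊥ := by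
  rintro rfl
  rw [Ideal.height_bot] at h
  exact absurd h (by norm_num)

/-- A homogeneous ideal of height at least two contains two coprime forms. -/
theorem exists_isRelPrime_forms [Infinite K] {I : Ideal (PolyRing K n)} (hI : IsHomogeneousIdeal I)
    (hproper : I ≠ ⊤) (h : 2 ≤ I.height) : ∃ r a F G, F ∈ idealPart I r ∧ G ∈ idealPart I a ∧
      F ≠ 0 ∧ G ≠ 0 ∧ IsRelPrime F G := by
  classical
  have hn := one_le_of_two_le_height hproper h
  obtain ⟨r, F, hF, hF0⟩ := exists_form_not_mem hI
    (fun h' => ne_bot_of_two_le_height h (le_bot_iff.1 h'))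
  have hF0 : F ≠ 0 := fun h' => hF0 (by simp [h'])
  obtain ⟨f, hf, hfF⟩ := UniqueFactorizationMonoid.exists_prime_factors F hF0
  have key : ∀ p : PolyRing K n, ∃ e, Prime p → ∃ g ∈ idealPart I e, ¬ p ∣ g := by
    intro p
    by_cases hp : Prime p
    · have hnot : ¬ I ≤ Ideal.span {p} := fun hle => by
        have := (h.trans (Ideal.height_mono hle)).trans
          (Ideal.height_span_singleton_le_one hp.not_isUnit)
        exact absurd this (by norm_num)
      obtain ⟨e, g, hg, hgp⟩ := exists_form_not_mem hI hnot
      exact ⟨e, fun _ => ⟨g, hg, fun h' => hgp (Ideal.mem_span_singleton.2 h')⟩⟩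
    · exact ⟨0, fun h => absurd h hp⟩
  choose e he using key
  let a := f.toFinset.sup e
  obtain ⟨G, hG, hFG⟩ := exists_isRelPrime_mem hF0 (idealPart I a) (by
    intro p hp hpF
    obtain ⟨q, hq, hpq⟩ := hp.exists_mem_multiset_dvd (hpF.trans hfF.symm.dvd)
    have hass := hp.associated_of_dvd (hf q hq) hpq
    obtain ⟨g, hg, hqg⟩ := he q (hf q hq)
    obtain ⟨i, hi⟩ := exists_not_dvd_X hn (hf q hq)
    have hle : e q ≤ a := Finset.le_sup (Multiset.mem_toFinset.2 hq)
    refine ⟨X i ^ (a - e q) * g, ⟨?_, I.mul_mem_left _ hg.2⟩, fun hdvd => ?_⟩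
    · have := (isHomogeneous_X_pow (R := K) i (a - e q)).mul (mem_idealPart.1 hg).1
      rwa [Nat.sub_add_cancel hle] at this
    · rcases (hf q hq).dvd_or_dvd (hass.symm.dvd.trans hdvd) with h1 | h1
      · exact hi ((hf q hq).dvd_of_dvd_pow h1)
      · exact hqg h1)
  refine ⟨r, a, F, G, hF, hG, hF0, ?_, hFG⟩
  rintro rfl
  exact hproper (Ideal.eq_top_of_isUnit_mem _ hF.2 (hFG dvd_rfl (dvd_zero _)))

/-! ### The general form is coprime to a given form -/

instance finite_degree_eq (d : ℕ) : Finite {m : Fin (n + 1) →₀ ℕ // m.degree = d} :=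
  (Finsupp.finite_of_degree_eq d).to_subtype

/-- A linear functional on the forms of degree `d`, as a polynomial in their coefficients. -/
noncomputable def functionalPoly (d : ℕ) (φ : PolyRing K n →ₗ[K] K) :
    MvPolynomial {m : Fin (n + 1) →₀ ℕ // m.degree = d} K :=
  let _ := Fintype.ofFinite {m : Fin (n + 1) →₀ ℕ // m.degree = d}
  ∑ m, C (φ (monomial m.1 1)) * X m

lemma eval_functionalPoly {d : ℕ} (φ : PolyRing K n →ₗ[K] K) {G : PolyRing K n}
    (hG : G.IsHomogeneous d) :
    MvPolynomial.eval (fun m : {m : Fin (n + 1) →₀ ℕ // m.degree = d} => coeff m.1 G)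
      (functionalPoly d φ) = φ G := by
  classical
  let _ := Fintype.ofFinite {m : Fin (n + 1) →₀ ℕ // m.degree = d}
  have hsum : G = ∑ m : {m : Fin (n + 1) →₀ ℕ // m.degree = d}, coeff m.1 G • monomial m.1 1 := by
    ext m
    simp only [coeff_sum, coeff_smul, coeff_monomial, smul_eq_mul, mul_ite, mul_one, mul_zero]
    by_cases hm : m.degree = d
    · rw [Finset.sum_eq_single (⟨m, hm⟩ : {m : Fin (n + 1) →₀ ℕ // m.degree = d})]
      · rw [if_pos rfl]
      · intro b _ hb
        exact if_neg fun h => hb (Subtype.ext h)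
      · simp
    · rw [hG.coeff_eq_zero hm]
      refine (Finset.sum_eq_zero fun b _ => if_neg ?_).symm
      rintro rfl
      exact hm b.2
  conv_rhs => rw [hsum, map_sum]
  simp only [functionalPoly, map_sum, map_mul, eval_C, eval_X, map_smul, smul_eq_mul]
  exact Finset.sum_congr rfl fun _ _ => mul_comm _ _

/-- For each prime factor `p` of `F` the multiples of `p` lie in a hyperplane of the space of forms
of degree `d`, so that a product of linear functionals detects forms coprime to `F`. -/
theorem forGeneralForm_isRelPrime (hn : 1 ≤ n) (d : ℕ) {F : PolyRing K n} (hF : F ≠ 0)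
    (hu : ¬ IsUnit F) : ForGeneralForm d (fun G => G ≠ 0 ∧ IsRelPrime F G) := by
  classical
  obtain ⟨f, hf, hfF⟩ := UniqueFactorizationMonoid.exists_prime_factors F hF
  have key : ∀ p : PolyRing K n, ∃ φ : PolyRing K n →ₗ[K] K, Prime p →
      functionalPoly d φ ≠ 0 ∧ ∀ G, p ∣ G → φ G = 0 := by
    intro p
    by_cases hp : Prime p
    · obtain ⟨i, hi⟩ := exists_not_dvd_X hn hp
      have hmem : (X i ^ d : PolyRing K n) ∉ (Ideal.span {p}).restrictScalars K := fun h =>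
        hi (hp.dvd_of_dvd_pow (Ideal.mem_span_singleton.1 h))
      obtain ⟨φ, hφ, hker⟩ := Submodule.exists_le_ker_of_notMem hmem
      refine ⟨φ, fun _ => ⟨fun h0 => hφ ?_, fun G hG => hker (Ideal.mem_span_singleton.2 hG)⟩⟩
      rw [← eval_functionalPoly φ (isHomogeneous_X_pow i d), h0, map_zero]
    · exact ⟨0, fun h => absurd h hp⟩
  choose φ hφ using key
  refine ⟨(f.map fun p => functionalPoly d (φ p)).prod, ?_, fun G hG hne => ?_⟩
  · rw [Ne, Multiset.prod_eq_zero_iff, Multiset.mem_map]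
    rintro ⟨p, hp, h0⟩
    exact (hφ p (hf p hp)).1 h0
  · have hrel : IsRelPrime F G := by
      refine isRelPrime_of_forall_prime hF hf hfF fun p hp hpG => hne ?_
      rw [map_multiset_prod, Multiset.map_map, Multiset.prod_eq_zero_iff, Multiset.mem_map]
      refine ⟨p, hp, ?_⟩
      rw [Function.comp_apply, eval_functionalPoly _ hG]
      exact (hφ p (hf p hp)).2 G hpG
    refine ⟨?_, hrel⟩
    rintro rfl
    exact hu (hrel dvd_rfl (dvd_zero _))

lemma ForGeneralForm.exists [Infinite K] {d : ℕ} {P : PolyRing K n → Prop}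
    (h : ForGeneralForm d P) : ∃ G : PolyRing K n, G.IsHomogeneous d ∧ P G := by
  classical
  obtain ⟨Φ, hΦ, hP⟩ := h
  let _ := Fintype.ofFinite {m : Fin (n + 1) →₀ ℕ // m.degree = d}
  obtain ⟨x, hx⟩ : ∃ x, MvPolynomial.eval x Φ ≠ 0 := by
    by_contra! h0
    exact hΦ (MvPolynomial.funext fun x => by rw [h0, map_zero])
  have hG : (∑ m : {m : Fin (n + 1) →₀ ℕ // m.degree = d}, monomial m.1 (x m)).IsHomogeneous d :=
    IsHomogeneous.sum _ _ _ fun m _ => isHomogeneous_monomial _ m.2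
  refine ⟨_, hG, hP _ hG ?_⟩
  suffices hc : (fun m : {m : Fin (n + 1) →₀ ℕ // m.degree = d} =>
      coeff m.1 (∑ m : {m : Fin (n + 1) →₀ ℕ // m.degree = d}, monomial m.1 (x m))) = x by
    rwa [hc]
  funext m
  rw [coeff_sum, Finset.sum_eq_single m]
  · simp
  · intro b _ hb
    rw [coeff_monomial, if_neg fun h => hb (Subtype.ext h)]
  · simp

/-! ### Basic double links -/

/-- The part of degree `t` of the graded module `I(-c)`. -/
noncomputable def shiftedPart (I : Ideal (PolyRing K n)) (c t : ℕ) : Submodule K (PolyRing K n) :=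
  restrictSupport K {m | m.degree + c = t} ⊓ I.restrictScalars K

lemma mem_shiftedPart {I : Ideal (PolyRing K n)} {c t : ℕ} {f : PolyRing K n} :
    f ∈ shiftedPart I c t ↔ shiftComponent c t f = f ∧ f ∈ I := by
  rw [shiftedPart, Submodule.mem_inf]
  refine and_congr ?_ Iff.rfl
  rw [mem_restrictSupport_iff]
  constructor
  · intro h
    ext m
    rw [coeff_shiftComponent]
    split_ifs with hm
    · rfl
    · by_contra h'
      exact hm (h (mem_support_iff.2 (Ne.symm h')))
  · intro h m hm
    by_contra hm'
    rw [← h, SetLike.mem_coe, mem_support_iff, coeff_shiftComponent] at hm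
    exact hm (if_neg hm')

lemma shiftComponent_shiftComponent (c t : ℕ) (f : PolyRing K n) :
    shiftComponent c t (shiftComponent c t f) = shiftComponent c t f := by
  ext m
  rw [coeff_shiftComponent, coeff_shiftComponent]
  split_ifs <;> rfl

lemma shiftComponent_mem {I : Ideal (PolyRing K n)} (hI : IsHomogeneousIdeal I) (c t : ℕ)
    {f : PolyRing K n} (hf : f ∈ I) : shiftComponent c t f ∈ I := by
  rw [shiftComponent]
  split_ifs
  · exact homogeneousComponent_mem_of_mem hI hf _
  · exact zero_mem _

lemma shiftComponent_mem_shiftedPart {I : Ideal (PolyRing K n)} (hI : IsHomogeneousIdeal I)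
    (c t : ℕ) {f : PolyRing K n} (hf : f ∈ I) : shiftComponent c t f ∈ shiftedPart I c t :=
  mem_shiftedPart.2 ⟨shiftComponent_shiftComponent c t f, shiftComponent_mem hI c t hf⟩

lemma shiftComponent_add (c t : ℕ) (f g : PolyRing K n) :
    shiftComponent c t (f + g) = shiftComponent c t f + shiftComponent c t g := by
  ext m
  simp only [coeff_shiftComponent, coeff_add]
  split_ifs <;> simp

lemma shiftComponent_mul {a : ℕ} {G : PolyRing K n} (hG : G.IsHomogeneous a) (b t : ℕ)
    (f : PolyRing K n) : shiftComponent b t (G * f) = G * shiftComponent (a + b) t f := by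
  have hD : IsGradedMatrix (fun _ : Fin 1 => b) (fun _ : Fin 1 => a + b)
      (Matrix.of fun _ _ => G) := by
    intro i j m hm
    by_contra h
    refine mem_support_iff.1 hm (hG.coeff_eq_zero fun h' => h ?_)
    rw [h']
  have h := congrFun (hD.vecComponent_mulVec t fun _ => f) 0
  simpa [vecComponent, Matrix.mulVec, dotProduct] using h

lemma idealPart_eq_shiftedPart (I : Ideal (PolyRing K n)) (t : ℕ) :
    idealPart I t = shiftedPart I 0 t := by
  rw [idealPart, shiftedPart, homogeneousSubmodule_eq_restrictSupport]
  rfl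

instance finiteDimensional_shiftedPart (I : Ideal (PolyRing K n)) (c t : ℕ) :
    FiniteDimensional K (shiftedPart I c t) :=
  Submodule.finiteDimensional_of_le
    (inf_le_left : _ ≤ restrictSupport K {m : Fin (n + 1) →₀ ℕ | m.degree + c = t})

lemma finrank_shiftedPart (I : Ideal (PolyRing K n)) (c t : ℕ) :
    (Module.finrank K (shiftedPart I c t) : ℤ) =
      PowerSeries.coeff t (PowerSeries.X ^ c * idealSeries I) := by
  rw [PowerSeries.coeff_X_pow_mul']
  split_ifs with h
  · rw [idealSeries, PowerSeries.coeff_mk, idealPart_eq_shiftedPart]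
    have : shiftedPart I c t = shiftedPart I 0 (t - c) := by
      rw [shiftedPart, shiftedPart]
      congr 2
      ext m
      simp only [Set.mem_ofPred_eq]
      omega
    rw [this]
  · have : shiftedPart I c t = ⊥ := by
      rw [eq_bot_iff]
      intro f hf
      have h1 := (mem_shiftedPart.1 hf).1
      rw [shiftComponent, if_neg h] at h1
      exact h1.symm
    rw [this, finrank_bot, Nat.cast_zero]

lemma finrank_map_mulLeft {G : PolyRing K n} (hG : G ≠ 0) (V : Submodule K (PolyRing K n)) :
    Module.finrank K (V.map (LinearMap.mulLeft K G)) = Module.finrank K V :=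
  (Submodule.equivMapOfInjective _ (mul_right_injective₀ hG) V).finrank_eq.symm

lemma isHomogeneousIdeal_basicDoubleLink {d a : ℕ} {I J : Ideal (PolyRing K n)}
    (hI : IsHomogeneousIdeal I) (h : IsBasicDoubleLink d a I J) : IsHomogeneousIdeal J := by
  obtain ⟨F, G, -, -, hF, -, -, hG, -, rfl⟩ := h
  have hspan : ∀ {e : ℕ} {P : PolyRing K n}, P.IsHomogeneous e →
      (Ideal.span {P}).IsHomogeneous (homogeneousSubmodule (Fin (n + 1)) K) := fun {e P} hP =>
    Ideal.homogeneous_span _ _ fun x hx => by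
      rw [Set.mem_singleton_iff.1 hx]
      exact ⟨e, hP⟩
  exact ((hspan hG).mul hI).sup (hspan hF)

/-- The Hilbert series of `J = G I + (F)`, from the exact sequence
`0 → R(-r-a) → I(-a) ⊕ R(-r) → J → 0`: the multiples of `F` and the elements of `G I` have exactly
the multiples of `F G` in common. -/
theorem idealSeries_span_mul_sup_span {I : Ideal (PolyRing K n)} (hI : IsHomogeneousIdeal I)
    {r a : ℕ} {F G : PolyRing K n} (hFI : F ∈ I) (hF0 : F ≠ 0) (hF : F.IsHomogeneous r)
    (hG0 : G ≠ 0) (hG : G.IsHomogeneous a) (hFG : IsRelPrime F G) :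
    idealSeries (Ideal.span {G} * I ⊔ Ideal.span {F}) +
        PowerSeries.X ^ (r + a) * idealSeries (⊤ : Ideal (PolyRing K n)) =
      PowerSeries.X ^ a * idealSeries I +
        PowerSeries.X ^ r * idealSeries (⊤ : Ideal (PolyRing K n)) := by
  have htop : IsHomogeneousIdeal (⊤ : Ideal (PolyRing K n)) := Ideal.IsHomogeneous.top _
  ext t
  have hsup : idealPart (Ideal.span {G} * I ⊔ Ideal.span {F}) t =
      (shiftedPart I a t).map (LinearMap.mulLeft K G) ⊔
        (shiftedPart ⊤ r t).map (LinearMap.mulLeft K F) := by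
    rw [idealPart_eq_shiftedPart]
    apply le_antisymm
    · intro f hf
      obtain ⟨hf1, hf2⟩ := mem_shiftedPart.1 hf
      obtain ⟨g, hg, h, hh, rfl⟩ := Submodule.mem_sup.1 hf2
      obtain ⟨u, hu, rfl⟩ := Ideal.mem_span_singleton_mul.1 hg
      obtain ⟨v, rfl⟩ := Ideal.mem_span_singleton.1 hh
      rw [← hf1, shiftComponent_add, shiftComponent_mul hG, shiftComponent_mul hF]
      exact Submodule.add_mem_sup
        (Submodule.mem_map_of_mem (shiftComponent_mem_shiftedPart hI (a + 0) t hu))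
        (Submodule.mem_map_of_mem (shiftComponent_mem_shiftedPart htop (r + 0) t trivial))
    · rw [sup_le_iff]
      constructor
      · rintro _ ⟨u, hu, rfl⟩
        obtain ⟨hu1, hu2⟩ := mem_shiftedPart.1 hu
        refine mem_shiftedPart.2 ⟨?_, Submodule.mem_sup_left
          (Ideal.mul_mem_mul (Ideal.mem_span_singleton_self G) hu2)⟩
        rw [LinearMap.mulLeft_apply, shiftComponent_mul hG, add_zero, hu1]
      · rintro _ ⟨v, hv, rfl⟩
        obtain ⟨hv1, -⟩ := mem_shiftedPart.1 hv
        refine mem_shiftedPart.2 ⟨?_, Submodule.mem_sup_right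
          (Ideal.mem_span_singleton.2 (dvd_mul_right F v))⟩
        rw [LinearMap.mulLeft_apply, shiftComponent_mul hF, add_zero, hv1]
  have hinf : (shiftedPart I a t).map (LinearMap.mulLeft K G) ⊓
        (shiftedPart ⊤ r t).map (LinearMap.mulLeft K F) =
      (shiftedPart ⊤ (r + a) t).map (LinearMap.mulLeft K (G * F)) := by
    apply le_antisymm
    · rintro f ⟨⟨u, hu, rfl⟩, ⟨v, -, hv⟩⟩
      obtain ⟨w, rfl⟩ : F ∣ u := hFG.dvd_of_dvd_mul_left ⟨v, hv.symm⟩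
      obtain ⟨hu1, -⟩ := mem_shiftedPart.1 hu
      rw [shiftComponent_mul hF] at hu1
      refine ⟨w, mem_shiftedPart.2 ⟨mul_left_cancel₀ hF0 hu1, trivial⟩, ?_⟩
      simp only [LinearMap.mulLeft_apply, mul_assoc]
    · rintro _ ⟨w, hw, rfl⟩
      obtain ⟨hw1, -⟩ := mem_shiftedPart.1 hw
      refine ⟨⟨F * w, mem_shiftedPart.2 ⟨?_, I.mul_mem_right _ hFI⟩, ?_⟩,
        ⟨G * w, mem_shiftedPart.2 ⟨?_, trivial⟩, ?_⟩⟩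
      · rw [shiftComponent_mul hF, hw1]
      · simp only [LinearMap.mulLeft_apply, mul_assoc]
      · rw [shiftComponent_mul hG, add_comm a r, hw1]
      · simp only [LinearMap.mulLeft_apply]; ring
  have h := Submodule.finrank_sup_add_finrank_inf_eq
    ((shiftedPart I a t).map (LinearMap.mulLeft K G))
    ((shiftedPart ⊤ r t).map (LinearMap.mulLeft K F))
  rw [← hsup, hinf, finrank_map_mulLeft hG0, finrank_map_mulLeft hF0,
    finrank_map_mulLeft (mul_ne_zero hG0 hF0)] at h
  rw [map_add, map_add, ← finrank_shiftedPart, ← finrank_shiftedPart, ← finrank_shiftedPart,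
    idealSeries, PowerSeries.coeff_mk]
  exact_mod_cast h

lemma span_pair_ne_top {F G : PolyRing K n} (hF : constantCoeff F = 0)
    (hG : constantCoeff G = 0) : Ideal.span {F, G} ≠ ⊤ := by
  intro h
  have hle : Ideal.span {F, G} ≤ RingHom.ker (constantCoeff (R := K) (σ := Fin (n + 1))) := by
    rw [Ideal.span_le]
    rintro x (rfl | rfl)
    · exact hF
    · exact hG
  rw [h] at hle
  have := hle (Submodule.mem_top (x := 1))
  rw [RingHom.mem_ker, map_one] at this
  exact one_ne_zero this

lemma constantCoeff_eq_zero_of_isHomogeneous {a : ℕ} (ha : 0 < a) {G : PolyRing K n}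
    (hG : G.IsHomogeneous a) : constantCoeff G = 0 := by
  rw [constantCoeff_eq]
  exact hG.coeff_eq_zero (by rw [map_zero]; exact ha.ne)

/-- A basic double link of a proper ideal of height at least two has height two: it lies in
`(F, G)`, and a prime containing it contains `I` or both `F` and `G`. -/
theorem height_basicDoubleLink {d a : ℕ} {I J : Ideal (PolyRing K n)}
    (hI : IsHomogeneousIdeal I) (hproper : I ≠ ⊤) (h2 : 2 ≤ I.height)
    (h : IsBasicDoubleLink d a I J) : J ≠ ⊤ ∧ J.height = 2 := by
  obtain ⟨F, G, hFI, hF0, hF, ha, hG0, hG, hFG, rfl⟩ := h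
  have hne := span_pair_ne_top (constantCoeff_eq_zero_of_mem hI hproper hFI)
    (constantCoeff_eq_zero_of_isHomogeneous ha hG)
  have hle : Ideal.span {G} * I ⊔ Ideal.span {F} ≤ Ideal.span {F, G} := by
    rw [sup_le_iff]
    constructor
    · exact Ideal.mul_le_left.trans ((Ideal.span_singleton_le_iff_mem _).2
        (Ideal.subset_span (Set.mem_insert_of_mem F (Set.mem_singleton G))))
    · exact (Ideal.span_singleton_le_iff_mem _).2 (Ideal.subset_span (Set.mem_insert F {G}))
  refine ⟨fun htop => hne (top_le_iff.1 (htop ▸ hle)), le_antisymm ?_ ?_⟩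
  · exact (Ideal.height_mono hle).trans (height_span_pair_le_two hne)
  · refine le_height_of_forall_isPrime fun P hP hJP => ?_
    have hFP : F ∈ P := hJP (Submodule.mem_sup_right (Ideal.mem_span_singleton_self F))
    rcases hP.mul_le.1 (le_sup_left.trans hJP) with hGP | hIP
    · exact two_le_height_of_isPrime hF0 hFG hFP
        (hGP (Ideal.mem_span_singleton_self G))
    · exact h2.trans (Ideal.height_mono hIP)

/-! ### The numerator vanishes to order two -/

lemma degree_le_of_eventually_le {p q : Polynomial ℝ}
    (h : ∀ᶠ k : ℕ in Filter.atTop, 0 ≤ p.eval (k : ℝ) ∧ p.eval (k : ℝ) ≤ q.eval (k : ℝ)) :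
    p.degree ≤ q.degree := by
  by_contra! hlt
  have hp : p ≠ 0 := fun h0 => by simp [h0] at hlt
  have h1 := (Polynomial.div_tendsto_atTop_zero_of_degree_lt q p hlt).comp
    tendsto_natCast_atTop_atTop
  have h2 := h1.eventually (gt_mem_nhds (zero_lt_one))
  have h3 : ∀ᶠ k : ℕ in Filter.atTop, p.eval (k : ℝ) ≠ 0 :=
    tendsto_natCast_atTop_atTop.eventually (p.eventually_atTop_not_isRoot hp)
  obtain ⟨k, ⟨h4, h5⟩, h6, h7⟩ := (h.and (h2.and h3)).exists
  have h8 : 0 < p.eval (k : ℝ) := lt_of_le_of_ne h4 (Ne.symm h7)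
  rw [Function.comp_apply, div_lt_one h8] at h6
  exact absurd h6 (not_lt.2 h5)

/-- If `N/(1-T)^{d+2}` has nonnegative coefficients bounded by those of a series `P/(1-T)^d`, then
`N` vanishes to order two at `1`, as shown by the degrees of the Hilbert polynomials. -/
lemma one_sub_X_sq_dvd_of_le_of_pos {d : ℕ} (hd : 0 < d) {N P : Polynomial ℤ} {A B : PowerSeries ℤ}
    (hA : A * (1 - PowerSeries.X : PowerSeries ℤ) ^ (d + 2) = (N : PowerSeries ℤ))
    (hB : B * (1 - PowerSeries.X : PowerSeries ℤ) ^ d = (P : PowerSeries ℤ))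
    (h0 : ∀ t, 0 ≤ PowerSeries.coeff t A)
    (hle : ∀ t, PowerSeries.coeff t A ≤ PowerSeries.coeff t B) :
    (1 - Polynomial.X) ^ 2 ∣ N := by
  let ι := Int.castRingHom ℝ
  have hinj : Function.Injective ι := Int.cast_injective
  have hser : ∀ {e : ℕ} {S : PowerSeries ℤ} {Q : Polynomial ℤ},
      S * (1 - PowerSeries.X : PowerSeries ℤ) ^ e = (Q : PowerSeries ℤ) → ∀ᶠ k : ℕ in Filter.atTop,
        ((PowerSeries.coeff k S : ℤ) : ℝ) =
          (Polynomial.hilbertPoly (Q.map ι) e).eval (k : ℝ) := by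
    intro e S Q hS
    filter_upwards [Filter.eventually_gt_atTop (Q.map ι).natDegree] with k hk
    rw [← Polynomial.coeff_mul_invOneSubPow_eq_hilbertPoly_eval e hk]
    have h1 : (PowerSeries.map ι) S =
        ((Q.map ι : Polynomial ℝ) : PowerSeries ℝ) * (PowerSeries.invOneSubPow ℝ e).val := by
      rw [Polynomial.polynomial_map_coe, ← hS, map_mul, map_pow, map_sub, map_one,
        PowerSeries.map_X, mul_assoc, ← PowerSeries.invOneSubPow_inv_eq_one_sub_pow,
        Units.inv_eq_val_inv, Units.inv_mul, mul_one]
    rw [← h1, PowerSeries.coeff_map]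
    rfl
  have hdeg := degree_le_of_eventually_le
    (p := Polynomial.hilbertPoly (N.map ι) (d + 2)) (q := Polynomial.hilbertPoly (P.map ι) d) (by
      filter_upwards [hser hA, hser hB] with k h1 h2
      rw [← h1, ← h2]
      exact ⟨by exact_mod_cast h0 k, by exact_mod_cast hle k⟩)
  by_cases hN : N = 0
  · rw [hN]; exact dvd_zero _
  have hN' : N.map ι ≠ 0 := (Polynomial.map_ne_zero_iff hinj).2 hN
  have hmult : 2 ≤ (N.map ι).rootMultiplicity 1 := by
    by_contra! hlt
    have hnd := Polynomial.natDegree_hilbertPoly_of_ne_zero_of_rootMultiplicity_lt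
      (p := N.map ι) (d := d + 2) hN' (by omega)
    have hq : (Polynomial.hilbertPoly (P.map ι) d).degree < (d : ℕ) := by
      by_cases hq0 : Polynomial.hilbertPoly (P.map ι) d = 0
      · rw [hq0, Polynomial.degree_zero]; exact WithBot.bot_lt_coe _
      · have h1 := Polynomial.natDegree_hilbertPoly_of_ne_zero hq0
        rw [Polynomial.degree_eq_natDegree hq0, h1]
        exact_mod_cast (by omega : d - (P.map ι).rootMultiplicity 1 - 1 < d)
    have hp0 : Polynomial.hilbertPoly (N.map ι) (d + 2) ≠ 0 := fun h0 => by
      rw [h0, Polynomial.natDegree_zero] at hnd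
      omega
    have h3 := hdeg.trans_lt hq
    rw [Polynomial.degree_eq_natDegree hp0, hnd] at h3
    have : d + 2 - (N.map ι).rootMultiplicity 1 - 1 < d := by exact_mod_cast h3
    omega
  rw [Polynomial.le_rootMultiplicity_iff hN'] at hmult
  have h1 : (Polynomial.X - Polynomial.C 1 : Polynomial ℤ) ^ 2 ∣ N := by
    rw [← Polynomial.map_dvd_map ι hinj ((Polynomial.monic_X_sub_C 1).pow 2)]
    simpa using hmult
  have h2 : (1 - Polynomial.X : Polynomial ℤ) ^ 2 = (Polynomial.X - Polynomial.C 1) ^ 2 := by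
    rw [Polynomial.C_1]; ring
  rw [h2]
  exact h1

lemma one_sub_X_sq_dvd_of_le {d : ℕ} {N P : Polynomial ℤ} {A B : PowerSeries ℤ}
    (hA : A * (1 - PowerSeries.X : PowerSeries ℤ) ^ (d + 2) = (N : PowerSeries ℤ))
    (hB : B * (1 - PowerSeries.X : PowerSeries ℤ) ^ d = (P : PowerSeries ℤ))
    (h0 : ∀ t, 0 ≤ PowerSeries.coeff t A)
    (hle : ∀ t, PowerSeries.coeff t A ≤ PowerSeries.coeff t B) :
    (1 - Polynomial.X) ^ 2 ∣ N := by
  -- Dividing by `1 - T` once more makes the exponent positive and keeps the inequalities.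
  have hmk := PowerSeries.mk_one_mul_one_sub_eq_one ℤ
  refine one_sub_X_sq_dvd_of_le_of_pos (d := d + 1) (by omega) (A := A * PowerSeries.mk 1)
    (B := B * PowerSeries.mk 1) (P := P) ?_ ?_ (fun t => ?_) (fun t => ?_)
  · rw [← hA]
    linear_combination A * (1 - PowerSeries.X) ^ (d + 2) * hmk
  · rw [← hB]
    linear_combination B * (1 - PowerSeries.X) ^ d * hmk
  · rw [PowerSeries.coeff_mul]
    exact Finset.sum_nonneg fun x _ => by simpa using h0 x.1
  · rw [PowerSeries.coeff_mul, PowerSeries.coeff_mul]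
    exact Finset.sum_le_sum fun x _ => by simpa using hle x.1

lemma coeff_quotSeries_anti {I J : Ideal (PolyRing K n)} (h : I ≤ J) (t : ℕ) :
    PowerSeries.coeff t (quotSeries J) ≤ PowerSeries.coeff t (quotSeries I) := by
  rw [eq_sub_of_add_eq (quotSeries_add_idealSeries J),
    eq_sub_of_add_eq (quotSeries_add_idealSeries I), map_sub, map_sub]
  refine sub_le_sub_left ?_ _
  simp only [idealSeries, PowerSeries.coeff_mk, Nat.cast_le]
  exact Submodule.finrank_mono fun f hf => ⟨hf.1, h hf.2⟩

/-- `R/I` is a quotient of the complete intersection `R/(F, G)` of two coprime forms, so its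
Hilbert function grows at most like a polynomial of degree `n - 2`. -/
theorem MinimalFreeResolution.one_sub_X_sq_dvd_numerator [Infinite K] {I : Ideal (PolyRing K n)}
    (ρ : MinimalFreeResolution I) (hI : IsHomogeneousIdeal I) (hproper : I ≠ ⊤)
    (h2 : 2 ≤ I.height) : (1 - Polynomial.X) ^ 2 ∣ ρ.numerator := by
  obtain ⟨d, rfl⟩ : ∃ d, n = d + 1 :=
    ⟨n - 1, by have := one_le_of_two_le_height hproper h2; omega⟩
  obtain ⟨r, a, F, G, hF, hG, hF0, hG0, hFG⟩ := exists_isRelPrime_forms hI hproper h2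
  have hser := idealSeries_span_mul_sup_span (I := ⊤) (Ideal.IsHomogeneous.top _)
    (Submodule.mem_top (x := F)) hF0 hF.1 hG0 hG.1 hFG
  set C : Ideal (PolyRing K (d + 1)) := Ideal.span {G} * ⊤ ⊔ Ideal.span {F} with hC
  have hCI : C ≤ I := by
    rw [hC, sup_le_iff, Ideal.mul_top, Ideal.span_singleton_le_iff_mem,
      Ideal.span_singleton_le_iff_mem]
    exact ⟨hG.2, hF.2⟩
  obtain ⟨P, hP⟩ := sub_dvd_pow_sub_pow (1 : Polynomial ℤ) Polynomial.X a
  obtain ⟨P', hP'⟩ := sub_dvd_pow_sub_pow (1 : Polynomial ℤ) Polynomial.X r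
  rw [one_pow] at hP hP'
  have hcoe : ∀ {e : ℕ} {S : Polynomial ℤ}, 1 - Polynomial.X ^ e = (1 - Polynomial.X) * S →
      (1 - PowerSeries.X ^ e : PowerSeries ℤ) = (1 - PowerSeries.X) * (S : PowerSeries ℤ) := by
    intro e S h
    simpa using congrArg (fun p : Polynomial ℤ => (p : PowerSeries ℤ)) h
  have hquot : quotSeries C * (1 - PowerSeries.X) ^ d =
      ((P * P' : Polynomial ℤ) : PowerSeries ℤ) := by
    apply mul_right_cancel₀ (pow_ne_zero 2 one_sub_X_ne_zero)
    have h1 : idealSeries C * (1 - PowerSeries.X) ^ (d + 1 + 1) =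
        PowerSeries.X ^ a + PowerSeries.X ^ r - PowerSeries.X ^ (r + a) := by
      rw [eq_sub_of_add_eq hser]
      linear_combination (PowerSeries.X ^ a + PowerSeries.X ^ r - PowerSeries.X ^ (r + a)) *
        idealSeries_top (K := K) (n := d + 1)
    rw [mul_assoc, ← pow_add, eq_sub_of_add_eq (quotSeries_add_idealSeries C), sub_mul]
    rw [idealSeries_top, h1, Polynomial.coe_mul]
    linear_combination (1 - PowerSeries.X ^ a) * hcoe hP' +
      (1 - PowerSeries.X) * (P' : PowerSeries ℤ) * hcoe hP
  refine one_sub_X_sq_dvd_of_le ρ.quotSeries_mul hquot (fun t => ?_) (coeff_quotSeries_anti hCI)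
  rw [quotSeries, PowerSeries.coeff_mk]
  exact Nat.cast_nonneg _

/-! ### The cancelled lists of shifts -/

lemma pairwise_cancelledList (a b : Multiset ℕ) : (cancelledList a b).Pairwise (· ≥ ·) :=
  Multiset.pairwise_sort _ _

lemma count_cancelledList (a b : Multiset ℕ) (t : ℕ) :
    (cancelledList a b).count t = a.count t - b.count t := by
  rw [cancelledList, ← Multiset.coe_count, Multiset.sort_eq, Multiset.count_sub]

/-- A non-increasing list is determined by the multiplicities of its entries. -/
lemma eq_of_pairwise_of_count_eq {l l' : List ℕ} (hl : l.Pairwise (· ≥ ·))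
    (hl' : l'.Pairwise (· ≥ ·)) (h : ∀ t, l.count t = l'.count t) : l = l' :=
  (List.perm_iff_count.2 h).eq_of_pairwise (fun _ _ _ _ h1 h2 => le_antisymm h2 h1) hl hl'

lemma count_eraseIdx_add {l : List ℕ} {i r : ℕ} (h : l[i]? = some r) (t : ℕ) :
    (l.eraseIdx i).count t + (if t = r then 1 else 0) = l.count t := by
  obtain ⟨hi, rfl⟩ := List.getElem?_eq_some_iff.1 h
  rw [← (List.getElem_cons_eraseIdx_perm hi).count_eq t, List.count_cons]
  simp only [eq_comm (a := t), beq_iff_eq]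

lemma count_map_add_eq (l : List ℕ) (d t : ℕ) :
    (l.map (· + d)).count t = if d ≤ t then l.count (t - d) else 0 := by
  split_ifs with h
  · obtain ⟨t, rfl⟩ := Nat.exists_eq_add_of_le' h
    rw [List.count_map_of_injective _ _ (add_left_injective d), Nat.add_sub_cancel]
  · rw [List.count_eq_zero, List.mem_map]
    rintro ⟨x, -, rfl⟩
    omega

lemma pairwise_map_add {l : List ℕ} (hl : l.Pairwise (· ≥ ·)) (d : ℕ) :
    (l.map (· + d)).Pairwise (· ≥ ·) :=
  List.pairwise_map.2 (hl.imp fun h => Nat.add_le_add_right h d)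

lemma diagonalList_eq_zipWith (s r : List ℕ) :
    diagonalList s r = List.zipWith (fun x y : ℕ => (x : ℤ) - (y : ℤ)) s r := by
  -- In `diagonalList` the coercion to `ℤ` is applied to the lists.
  have h : ∀ l : List ℕ, (l >>= fun a => pure (Nat.cast a) : List ℤ) =
      l.map (Nat.cast : ℕ → ℤ) := fun l => by
    induction l <;> simp_all
  exact (congrArg₂ (List.zipWith fun x y : ℤ => x - y) (h s) (h r)).trans List.zipWith_map

lemma diagonalList_map_add (s r : List ℕ) (d : ℕ) :
    diagonalList (s.map (· + d)) (r.map (· + d)) = diagonalList s r := by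
  rw [diagonalList_eq_zipWith, diagonalList_eq_zipWith, List.zipWith_map]
  congr 1
  funext x y
  push_cast
  ring

lemma diagonalList_eraseIdx (s r : List ℕ) (i : ℕ) :
    diagonalList (s.eraseIdx i) (r.eraseIdx i) = (diagonalList s r).eraseIdx i := by
  simp only [diagonalList_eq_zipWith]
  induction s generalizing r i with
  | nil => simp
  | cons x s ih =>
    cases r with
    | nil => simp
    | cons y r =>
      cases i with
      | zero => simp
      | succ i => simpa using ih r i

namespace MinimalFreeResolution

variable {I : Ideal (PolyRing K n)} (ρ : MinimalFreeResolution I)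

lemma coeff_one_sub_numerator (t : ℕ) :
    (1 - ρ.numerator).coeff t = (ρ.oddShifts.count t : ℤ) - ρ.evenShifts.count t := by
  rw [numerator, sub_add, sub_sub_cancel, Polynomial.coeff_sub, coeff_shiftPoly, coeff_shiftPoly]

/-- The multiplicities of the lists `r` and `s` are the positive and negative coefficients of the
numerator of the Hilbert series, so that the lists only depend on the Hilbert function. -/
lemma count_rList (t : ℕ) : ρ.rList.count t = ((1 - ρ.numerator).coeff t).toNat := by
  rw [rList, count_cancelledList, coeff_one_sub_numerator]
  omega

lemma count_sList (t : ℕ) : ρ.sList.count t = (-(1 - ρ.numerator).coeff t).toNat := by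
  rw [sList, count_cancelledList, coeff_one_sub_numerator]
  omega

lemma pairwise_rList : ρ.rList.Pairwise (· ≥ ·) := pairwise_cancelledList _ _

lemma pairwise_sList : ρ.sList.Pairwise (· ≥ ·) := pairwise_cancelledList _ _

lemma numerator_eq (ρ' : MinimalFreeResolution I) : ρ.numerator = ρ'.numerator := by
  rw [← Polynomial.coe_inj, ← ρ.quotSeries_mul, ρ'.quotSeries_mul]

lemma diagonal_eq (ρ' : MinimalFreeResolution I) : ρ.diagonal = ρ'.diagonal := by
  have hr : ρ.rList = ρ'.rList := eq_of_pairwise_of_count_eq ρ.pairwise_rList ρ'.pairwise_rList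
    fun t => by rw [count_rList, count_rList, numerator_eq ρ ρ']
  have hs : ρ.sList = ρ'.sList := eq_of_pairwise_of_count_eq ρ.pairwise_sList ρ'.pairwise_sList
    fun t => by rw [count_sList, count_sList, numerator_eq ρ ρ']
  rw [diagonal, diagonal, hr, hs]

lemma numNegative_eq (ρ' : MinimalFreeResolution I) : ρ.numNegative = ρ'.numNegative := by
  rw [numNegative, numNegative, ρ.diagonal_eq ρ']

/-! ### The effect of a basic double link on the lists of shifts -/

lemma coeff_one_sub_numerator_of_isBasicDoubleLink (hI : IsHomogeneousIdeal I) {r d : ℕ}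
    {J : Ideal (PolyRing K n)} (h : IsBasicDoubleLink r d I J) (ρ' : MinimalFreeResolution J)
    (t : ℕ) : (1 - ρ'.numerator).coeff t =
      (if d ≤ t then (1 - ρ.numerator).coeff (t - d) else 0) +
        (if t = r then 1 else 0) - (if t = r + d then 1 else 0) := by
  obtain ⟨F, G, hFI, hF0, hF, -, hG0, hG, hFG, rfl⟩ := h
  have hser := idealSeries_span_mul_sup_span hI hFI hF0 hF hG0 hG hFG
  have key : (1 - ρ'.numerator : Polynomial ℤ) =
      Polynomial.X ^ d * (1 - ρ.numerator) + Polynomial.X ^ r - Polynomial.X ^ (r + d) := by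
    rw [← Polynomial.coe_inj, ← ρ'.idealSeries_mul, eq_sub_of_add_eq hser, Polynomial.coe_sub,
      Polynomial.coe_add, Polynomial.coe_mul, ← ρ.idealSeries_mul]
    simp only [Polynomial.coe_pow, Polynomial.coe_X]
    linear_combination (PowerSeries.X ^ r - PowerSeries.X ^ (r + d)) *
      idealSeries_top (K := K) (n := n)
  rw [key, Polynomial.coeff_sub, Polynomial.coeff_add, Polynomial.coeff_X_pow_mul',
    Polynomial.coeff_X_pow, Polynomial.coeff_X_pow]

variable {ρ}

lemma IsFirstNegative.sList_getElem? {i r d : ℕ} (h : ρ.IsFirstNegative i r d) :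
    ∃ s, ρ.sList[i]? = some s ∧ r = s + d := by
  obtain ⟨h1, -, h3, -⟩ := h
  rw [diagonal, diagonalList_eq_zipWith, List.getElem?_zipWith_eq_some] at h1
  obtain ⟨s, r', hs, hr', heq⟩ := h1
  rw [h3, Option.some_inj] at hr'
  subst hr'
  exact ⟨s, hs, by omega⟩

lemma IsFirstNegative.coeff_pos {i r d : ℕ} (h : ρ.IsFirstNegative i r d) :
    0 < (1 - ρ.numerator).coeff r := by
  have h1 := List.count_pos_iff.2 (List.mem_of_getElem? h.2.2.1)
  rw [count_rList] at h1
  omega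

lemma coeff_neg_of_sList_getElem? {i s : ℕ} (h : ρ.sList[i]? = some s) :
    (1 - ρ.numerator).coeff s < 0 := by
  have h1 := List.count_pos_iff.2 (List.mem_of_getElem? h)
  rw [count_sList] at h1
  omega

/-- The basic double link raises all shifts by `d`; the new shifts `r_i` and `r_i + d` cancel
against the old shifts `s_i = r_i - d` and `r_i`, raised by `d`. -/
theorem IsFirstNegative.diagonal_eq_eraseIdx (hI : IsHomogeneousIdeal I) {i r d : ℕ}
    (h : ρ.IsFirstNegative i r d) {J : Ideal (PolyRing K n)} (hJ : IsBasicDoubleLink r d I J)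
    (ρ' : MinimalFreeResolution J) : ρ'.diagonal = ρ.diagonal.eraseIdx i := by
  obtain ⟨s, hs, hrs⟩ := h.sList_getElem?
  have hd := h.2.1
  have hr := h.2.2.1
  have hpos := h.coeff_pos
  have hneg := coeff_neg_of_sList_getElem? hs
  have hcoeff := ρ.coeff_one_sub_numerator_of_isBasicDoubleLink hI hJ ρ'
  have hrl : ρ'.rList = (ρ.rList.eraseIdx i).map (· + d) := by
    refine eq_of_pairwise_of_count_eq ρ'.pairwise_rList
      (pairwise_map_add (ρ.pairwise_rList.sublist (List.eraseIdx_sublist _ _)) d) fun t => ?_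
    rw [count_map_add_eq, count_rList, hcoeff]
    split_ifs with h1 h2 h3 h3 h2 h3 h3 <;> try omega
    all_goals
      have h4 := count_eraseIdx_add hr (t - d)
      rw [count_rList] at h4
    · obtain rfl : t - d = s := by omega
      rw [if_neg (by omega)] at h4
      omega
    · obtain rfl : t - d = r := by omega
      rw [if_pos rfl] at h4
      omega
    · rw [if_neg (by omega)] at h4
      omega
  have hsl : ρ'.sList = (ρ.sList.eraseIdx i).map (· + d) := by
    refine eq_of_pairwise_of_count_eq ρ'.pairwise_sList
      (pairwise_map_add (ρ.pairwise_sList.sublist (List.eraseIdx_sublist _ _)) d) fun t => ?_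
    rw [count_map_add_eq, count_sList, hcoeff]
    split_ifs with h1 h2 h3 h3 h2 h3 h3 <;> try omega
    all_goals
      have h4 := count_eraseIdx_add hs (t - d)
      rw [count_sList] at h4
    · obtain rfl : t - d = s := by omega
      rw [if_pos rfl] at h4
      omega
    · obtain rfl : t - d = r := by omega
      rw [if_neg (by omega)] at h4
      omega
    · rw [if_neg (by omega)] at h4
      omega
  rw [diagonal, hrl, hsl, diagonalList_map_add, diagonalList_eraseIdx, diagonal]

lemma IsFirstNegative.numNegative_eq (hI : IsHomogeneousIdeal I) {i r d : ℕ}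
    (h : ρ.IsFirstNegative i r d) {J : Ideal (PolyRing K n)} (hJ : IsBasicDoubleLink r d I J)
    (ρ' : MinimalFreeResolution J) : ρ'.numNegative + 1 = ρ.numNegative := by
  obtain ⟨hi, hdi⟩ := List.getElem?_eq_some_iff.1 h.1
  have hd := h.2.1
  rw [numNegative, numNegative, h.diagonal_eq_eraseIdx hI hJ ρ',
    ← (List.getElem_cons_eraseIdx_perm hi).countP_eq, List.countP_cons, hdi, if_pos]
  simpa using hd

variable (ρ)

lemma exists_isFirstNegative (h : 0 < ρ.numNegative) : ∃ i r d, ρ.IsFirstNegative i r d := by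
  classical
  obtain ⟨e, he, hneg⟩ := List.countP_pos_iff.1 h
  obtain ⟨j, hj, rfl⟩ := List.getElem_of_mem he
  let P : ℕ → Prop := fun j => ∃ e, ρ.diagonal[j]? = some e ∧ e < 0
  have hPj : P j := ⟨_, List.getElem?_eq_getElem hj, by simpa using hneg⟩
  obtain ⟨e, hie, he0⟩ : P (Nat.findGreatest P ρ.diagonal.length) :=
    Nat.findGreatest_spec hj.le hPj
  set i := Nat.findGreatest P ρ.diagonal.length with hi
  have hie' := hie
  rw [diagonal, diagonalList_eq_zipWith, List.getElem?_zipWith_eq_some] at hie'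
  obtain ⟨s, r, hs, hr, heq⟩ := hie'
  refine ⟨i, r, (-e).toNat, ?_, by omega, hr, fun k hk e' he' => ?_⟩
  · rw [hie]; congr 1; omega
  · by_contra! hlt
    have hkl : k ≤ ρ.diagonal.length := (List.getElem?_eq_some_iff.1 he').1.le
    exact Nat.findGreatest_is_greatest hk hkl ⟨e', he', hlt⟩

/-- The Hilbert series of `I` has numerator `1 - N`, for `N` the numerator of that of `R/I`. If the
coefficient of `T^r` in `1 - N` is not zero, `I` has a nonzero form of degree at most `r`, which
may be multiplied by a power of a variable. -/
lemma exists_form_of_coeff_pos {r : ℕ} (h : 0 < (1 - ρ.numerator).coeff r) :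
    ∃ F ∈ I, F ≠ 0 ∧ F.IsHomogeneous r := by
  by_contra! hc
  have hzero : ∀ t ≤ r, PowerSeries.coeff t (idealSeries I) = 0 := by
    intro t ht
    have hbot : idealPart I t = ⊥ := by
      rw [eq_bot_iff]
      intro f hf
      by_contra hf0
      refine hc (X 0 ^ (r - t) * f) (I.mul_mem_left _ hf.2)
        (mul_ne_zero (pow_ne_zero _ (X_ne_zero 0)) hf0) ?_
      have := (isHomogeneous_X_pow (R := K) (0 : Fin (n + 1)) (r - t)).mul hf.1
      rwa [Nat.sub_add_cancel ht] at this
    rw [idealSeries, PowerSeries.coeff_mk, hbot, finrank_bot, Nat.cast_zero]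
  have h1 : PowerSeries.coeff r ((1 - ρ.numerator : Polynomial ℤ) : PowerSeries ℤ) = 0 := by
    rw [← ρ.idealSeries_mul, PowerSeries.coeff_mul]
    refine Finset.sum_eq_zero fun x hx => ?_
    rw [Finset.HasAntidiagonal.mem_antidiagonal] at hx
    rw [hzero x.1 (by omega), zero_mul]
  rw [Polynomial.coeff_coe] at h1
  omega

end MinimalFreeResolution

/-! ### A nonnegative diagonal gives an admissible `h`-vector -/

lemma countP_le_of_forall₂_lt {r s : List ℕ} (h : List.Forall₂ (· < ·) r s) (t : ℕ) :
    s.countP (fun x => decide (x ≤ t)) ≤ r.countP (fun x => decide (x ≤ t)) := by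
  induction h with
  | nil => simp
  | cons hxy _ ih =>
    rw [List.countP_cons, List.countP_cons]
    simp only [decide_eq_true_eq]
    split_ifs <;> omega

lemma countP_le_succ (l : List ℕ) (t : ℕ) : l.countP (fun x => decide (x ≤ t + 1)) =
    l.countP (fun x => decide (x ≤ t)) + l.count (t + 1) := by
  induction l with
  | nil => simp
  | cons a l ih =>
    rw [List.countP_cons, List.countP_cons, List.count_cons, ih]
    simp only [decide_eq_true_eq, beq_iff_eq]
    split_ifs <;> omega

lemma countP_le_zero (l : List ℕ) : l.countP (fun x => decide (x ≤ 0)) = l.count 0 := by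
  rw [List.count]
  congr 1
  funext x
  rw [Bool.eq_iff_iff]
  simp

lemma coeff_zero_one_sub_X_mul (p : Polynomial ℤ) :
    ((1 - Polynomial.X) * p).coeff 0 = p.coeff 0 := by
  rw [sub_mul, one_mul, Polynomial.coeff_sub, Polynomial.coeff_X_mul_zero, sub_zero]

lemma coeff_succ_one_sub_X_mul (p : Polynomial ℤ) (t : ℕ) :
    ((1 - Polynomial.X) * p).coeff (t + 1) = p.coeff (t + 1) - p.coeff t := by
  rw [sub_mul, one_mul, Polynomial.coeff_sub, Polynomial.coeff_X_mul]

lemma eval_one_shiftPoly (s : Multiset ℕ) : (shiftPoly s).eval 1 = Multiset.card s := by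
  induction s using Multiset.induction_on with
  | empty => simp [shiftPoly_zero]
  | cons a s ih =>
    rw [shiftPoly_cons, Polynomial.eval_add, ih]
    simp [add_comm]

/-- The Hilbert function `H` of a graded quotient of `K[x, y]` by a lexicographic ideal of finite
colength: `H` grows as `t + 1` up to some degree and does not increase afterwards. The condition
`succ_le` says that the monomials `x^i y^(t-i)` with `H t ≤ i` span an ideal. -/
structure IsHVector (H : ℕ → ℕ) : Prop where
  zero : H 0 = 1
  le_succ : ∀ t, H t ≤ t + 1
  succ_le : ∀ t i, H t ≤ i → i ≤ t → H (t + 1) ≤ i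
  exists_eq_zero : ∃ t, H t = 0

/-- If the first difference of `h` is one below degree `a` and nonpositive from degree `a` on, then
the coefficients of `h` form an `h`-vector. -/
lemma exists_isHVector {h : Polynomial ℤ} {a : ℕ} (h0 : h.coeff 0 = 1)
    (hlt : ∀ t < a, ((1 - Polynomial.X) * h).coeff t = 1)
    (hge : ∀ t, a ≤ t → ((1 - Polynomial.X) * h).coeff t ≤ 0) :
    ∃ H : ℕ → ℕ, IsHVector H ∧ ∀ t, (H t : ℤ) = h.coeff t := by
  have ha : 0 < a := by
    by_contra! hle
    have := hge 0 hle
    rw [coeff_zero_one_sub_X_mul] at this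
    omega
  have hsmall : ∀ t < a, h.coeff t = t + 1 := by
    intro t
    induction t with
    | zero => intro _; simpa using h0
    | succ t ih =>
      intro ht
      have h1 := hlt (t + 1) ht
      rw [coeff_succ_one_sub_X_mul, ih (by omega)] at h1
      push_cast
      linarith
  have hstep : ∀ t, a ≤ t + 1 → h.coeff (t + 1) ≤ h.coeff t := by
    intro t ht
    have h1 := hge (t + 1) ht
    rw [coeff_succ_one_sub_X_mul] at h1
    linarith
  have hanti : ∀ k t, a ≤ t → h.coeff (t + k) ≤ h.coeff t := by
    intro k
    induction k with
    | zero => intro t _; exact le_rfl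
    | succ k ih =>
      intro t ht
      exact (hstep (t + k) (by omega)).trans (ih t ht)
  have hnonneg : ∀ t, 0 ≤ h.coeff t := by
    intro t
    rcases lt_or_ge t a with ht | ht
    · rw [hsmall t ht]; positivity
    · refine le_trans (le_of_eq ?_) (hanti (h.natDegree + 1) t ht)
      exact (Polynomial.coeff_eq_zero_of_natDegree_lt (by omega)).symm
  have hcast : ∀ t, ((h.coeff t).toNat : ℤ) = h.coeff t := fun t => Int.toNat_of_nonneg (hnonneg t)
  refine ⟨fun t => (h.coeff t).toNat, ⟨by simp [h0], fun t => ?_, fun t i hti hit => ?_,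
    h.natDegree + 1, ?_⟩, hcast⟩
  · rcases lt_or_ge t a with ht | ht
    · have := hsmall t ht; omega
    · obtain ⟨b, rfl⟩ : ∃ b, a = b + 1 := ⟨a - 1, by omega⟩
      have h1 := hsmall b (by omega)
      have h2 := hstep b le_rfl
      have h3 := hanti (t - (b + 1)) (b + 1) le_rfl
      rw [Nat.add_sub_cancel' ht] at h3
      omega
  · rcases lt_or_ge t a with ht | ht
    · have := hsmall t ht; omega
    · have := hstep t (by omega); omega
  · rw [Polynomial.coeff_eq_zero_of_natDegree_lt (Nat.lt_succ_self _)]; rfl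

namespace MinimalFreeResolution

variable {I : Ideal (PolyRing K n)} (ρ : MinimalFreeResolution I)

lemma coeff_one_sub_numerator_eq_count (t : ℕ) :
    (1 - ρ.numerator).coeff t = (ρ.rList.count t : ℤ) - ρ.sList.count t := by
  rw [count_rList, count_sList]
  omega

lemma one_sub_numerator_eq_shiftPoly :
    1 - ρ.numerator = shiftPoly (ρ.rList : Multiset ℕ) - shiftPoly (ρ.sList : Multiset ℕ) := by
  ext t
  rw [coeff_one_sub_numerator_eq_count, Polynomial.coeff_sub, coeff_shiftPoly, coeff_shiftPoly,
    Multiset.coe_count, Multiset.coe_count]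

lemma coeff_numerator_zero (hI : IsHomogeneousIdeal I) (hproper : I ≠ ⊤) :
    ρ.numerator.coeff 0 = 1 := by
  have hbot : idealPart I 0 = ⊥ := by
    rw [eq_bot_iff]
    intro f hf
    have h1 := homogeneousComponent_eq_self (mem_idealPart.1 hf).1
    rw [homogeneousComponent_zero, ← constantCoeff_eq,
      constantCoeff_eq_zero_of_mem hI hproper hf.2, C_0] at h1
    exact h1.symm
  have h1 : PowerSeries.coeff 0 ((1 - ρ.numerator : Polynomial ℤ) : PowerSeries ℤ) = 0 := by
    rw [← ρ.idealSeries_mul, PowerSeries.coeff_zero_eq_constantCoeff, map_mul,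
      ← PowerSeries.coeff_zero_eq_constantCoeff, idealSeries, PowerSeries.coeff_mk, hbot,
      finrank_bot, Nat.cast_zero, zero_mul]
  rw [Polynomial.coeff_coe, Polynomial.coeff_sub, Polynomial.coeff_one_zero] at h1
  omega

lemma length_rList (h : (1 - Polynomial.X) ^ 2 ∣ ρ.numerator) :
    ρ.rList.length = ρ.sList.length + 1 := by
  have h1 : ρ.numerator.eval 1 = 0 := by
    obtain ⟨q, hq⟩ := h
    rw [hq]
    simp
  have h2 := congrArg (Polynomial.eval 1) ρ.one_sub_numerator_eq_shiftPoly
  rw [Polynomial.eval_sub, Polynomial.eval_sub, eval_one_shiftPoly, eval_one_shiftPoly, h1,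
    Polynomial.eval_one, Multiset.coe_card, Multiset.coe_card] at h2
  omega

lemma forall₂_of_numNegative_eq_zero (h : (1 - Polynomial.X) ^ 2 ∣ ρ.numerator)
    (h0 : ρ.numNegative = 0) :
    ∃ l a, ρ.rList = l ++ [a] ∧ List.Forall₂ (· < ·) l ρ.sList := by
  have hlen := ρ.length_rList h
  have hne : ρ.rList ≠ [] := by
    intro h'
    rw [h'] at hlen
    simp at hlen
  refine ⟨ρ.rList.dropLast, ρ.rList.getLast hne, (List.dropLast_append_getLast hne).symm, ?_⟩
  rw [List.forall₂_iff_get]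
  refine ⟨by rw [List.length_dropLast]; omega, fun i hi1 hi2 => ?_⟩
  simp only [List.get_eq_getElem, List.getElem_dropLast]
  rw [List.length_dropLast] at hi1
  have hi : i < ρ.rList.length := by omega
  have hmem : ((ρ.sList[i] : ℤ) - (ρ.rList[i] : ℤ)) ∈ ρ.diagonal := by
    apply List.mem_of_getElem? (i := i)
    rw [diagonal, diagonalList_eq_zipWith, List.getElem?_zipWith_eq_some]
    exact ⟨_, _, List.getElem?_eq_getElem hi2, List.getElem?_eq_getElem hi, rfl⟩
  have hnn := List.countP_eq_zero.1 h0 _ hmem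
  have hne' : ρ.sList[i] ≠ ρ.rList[i] := by
    intro heq
    have h1 := List.count_pos_iff.2 (List.getElem_mem hi2)
    have h2 := List.count_pos_iff.2 (List.getElem_mem hi)
    rw [count_sList, heq] at h1
    rw [count_rList] at h2
    omega
  simp only [decide_eq_true_eq, not_lt] at hnn
  omega

/-- If the main diagonal has no negative entries, the numerator divided by `(1 - T)^2` is the
generating function of an `h`-vector: its first difference in degree `t` is
`1 - #{r_i ≤ t} + #{s_i ≤ t}`. -/
theorem exists_isHVector_of_numNegative_eq_zero (hI : IsHomogeneousIdeal I) (hproper : I ≠ ⊤)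
    (h : (1 - Polynomial.X) ^ 2 ∣ ρ.numerator) (h0 : ρ.numNegative = 0) :
    ∃ (H : ℕ → ℕ) (p : Polynomial ℤ), IsHVector H ∧ (∀ t, (H t : ℤ) = p.coeff t) ∧
      ρ.numerator = p * (1 - Polynomial.X) ^ 2 := by
  obtain ⟨l, a, hr, hl⟩ := ρ.forall₂_of_numNegative_eq_zero h h0
  obtain ⟨p, hp⟩ := h
  have hg : ∀ t, ((1 - Polynomial.X) * p).coeff t =
      1 - (ρ.rList.countP (fun x => decide (x ≤ t)) : ℤ) +
        ρ.sList.countP (fun x => decide (x ≤ t)) := by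
    have hN : ρ.numerator = (1 - Polynomial.X) * ((1 - Polynomial.X) * p) := by rw [hp]; ring
    intro t
    have hc := ρ.coeff_one_sub_numerator_eq_count t
    rw [Polynomial.coeff_sub] at hc
    induction t with
    | zero =>
      rw [hN, coeff_zero_one_sub_X_mul, Polynomial.coeff_one_zero] at hc
      rw [countP_le_zero, countP_le_zero]
      linarith
    | succ t ih =>
      have hc' := ρ.coeff_one_sub_numerator_eq_count t
      rw [Polynomial.coeff_sub] at hc'
      have ih := ih hc'
      rw [hN, coeff_succ_one_sub_X_mul, Polynomial.coeff_one, if_neg (Nat.succ_ne_zero t)] at hc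
      rw [countP_le_succ, countP_le_succ]
      push_cast
      linarith
  have hcount := countP_le_of_forall₂_lt hl
  have hrc : ∀ t, ρ.rList.countP (fun x => decide (x ≤ t)) =
      l.countP (fun x => decide (x ≤ t)) + if a ≤ t then 1 else 0 := by
    intro t
    rw [hr, List.countP_append, List.countP_singleton]
    simp
  have hla : ∀ x ∈ l, a ≤ x := by
    have := ρ.pairwise_rList
    rw [hr, List.pairwise_append] at this
    intro x hx
    exact this.2.2 x hx a (List.mem_singleton_self a)
  obtain ⟨H, hH, hHp⟩ := exists_isHVector (h := p) (a := a) (by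
      have h1 := ρ.coeff_numerator_zero hI hproper
      rw [hp, sq, mul_assoc, coeff_zero_one_sub_X_mul, coeff_zero_one_sub_X_mul] at h1
      exact h1) (by
      intro t ht
      have h1 : l.countP (fun x => decide (x ≤ t)) = 0 := by
        rw [List.countP_eq_zero]
        intro x hx
        have := hla x hx
        simp only [decide_eq_true_eq, not_le]
        omega
      have h2 := hcount t
      rw [hg, hrc, h1, if_neg (by omega)]
      omega) (by
      intro t ht
      have h2 := hcount t
      rw [hg, hrc, if_pos ht]
      push_cast
      omega)
  exact ⟨H, p, hH, hHp, by rw [hp, mul_comm]⟩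

end MinimalFreeResolution

/-! ### Arithmetically Cohen-Macaulay monomial ideals of codimension two -/

lemma mem_restrictSupportIdeal {s : Set (Fin (n + 1) →₀ ℕ)} {hs : IsUpperSet s}
    {f : PolyRing K n} :
    f ∈ restrictSupportIdeal (R := K) s hs ↔ ∀ m, coeff m f ≠ 0 → m ∈ s := by
  change f ∈ restrictSupport K s ↔ _
  rw [mem_restrictSupport_iff]
  simp [Set.subset_def]

lemma restrictSupportIdeal_le {s : Set (Fin (n + 1) →₀ ℕ)} {hs : IsUpperSet s}
    {L : Ideal (PolyRing K n)} (h : ∀ m ∈ s, monomial m 1 ∈ L) :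
    restrictSupportIdeal (R := K) s hs ≤ L := by
  intro f hf
  rw [← support_sum_monomial_coeff f]
  refine Submodule.sum_mem _ fun m hm => ?_
  have : monomial m (coeff m f) = C (coeff m f) * monomial m 1 := by
    rw [C_mul_monomial, mul_one]
  rw [this]
  exact L.mul_mem_left _ (h m (mem_restrictSupportIdeal.1 hf m (mem_support_iff.1 hm)))

lemma monomial_mem_restrictSupportIdeal {s : Set (Fin (n + 1) →₀ ℕ)} {hs : IsUpperSet s}
    {m : Fin (n + 1) →₀ ℕ} (hm : m ∈ s) :
    (monomial m 1 : PolyRing K n) ∈ restrictSupportIdeal (R := K) s hs :=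
  (monomial_mem_restrictSupport K).2 (Or.inl hm)

lemma isHomogeneousIdeal_restrictSupportIdeal {s : Set (Fin (n + 1) →₀ ℕ)} (hs : IsUpperSet s) :
    IsHomogeneousIdeal (restrictSupportIdeal (R := K) s hs) := by
  intro i f hf
  have h : (DirectSum.decompose (homogeneousSubmodule (Fin (n + 1)) K) f i : PolyRing K n) =
      homogeneousComponent i f := decomposition.decompose'_apply f i
  rw [h, mem_restrictSupportIdeal]
  intro m hm
  rw [coeff_homogeneousComponent] at hm
  exact mem_restrictSupportIdeal.1 hf m (fun h0 => hm (by simp [h0]))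

lemma X_mul_mem_restrictSupportIdeal_iff {s : Set (Fin (n + 1) →₀ ℕ)} {hs : IsUpperSet s}
    {j : Fin (n + 1)} (hj : ∀ m, m + Finsupp.single j 1 ∈ s → m ∈ s) {f : PolyRing K n} :
    X j * f ∈ restrictSupportIdeal (R := K) s hs ↔ f ∈ restrictSupportIdeal (R := K) s hs := by
  refine ⟨fun h => ?_, fun h => Ideal.mul_mem_left _ _ h⟩
  rw [mem_restrictSupportIdeal] at h ⊢
  intro m hm
  refine hj m (h _ ?_)
  rwa [add_comm m, coeff_X_mul]

lemma monomial_mem_of_X_mem {L : Ideal (PolyRing K n)} {j : Fin (n + 1)} (hj : X j ∈ L)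
    {m : Fin (n + 1) →₀ ℕ} (hm : m j ≠ 0) : monomial m 1 ∈ L := by
  have hle : Finsupp.single j 1 ≤ m := by rw [Finsupp.single_le_iff]; omega
  have : (monomial m 1 : PolyRing K n) = monomial (m - Finsupp.single j 1) 1 * X j := by
    rw [X, monomial_mul, tsub_add_cancel_of_le hle, mul_one]
  rw [this]
  exact L.mul_mem_left _ hj

section LexIdeal

variable {k : ℕ} {H : ℕ → ℕ}

/-- The monomials `x_0^i x_1^(t-i) ⋯` with `H t ≤ i`, together with the multiples of the first `e`
of the variables `x_2, x_3, …`. -/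
def lexMonomials (k : ℕ) (H : ℕ → ℕ) (e : ℕ) : Set (Fin (k + 1 + 1) →₀ ℕ) :=
  {m | H (m 0 + m 1) ≤ m 0 ∨ ∃ j : Fin k, j.val < e ∧ m j.succ.succ ≠ 0}

lemma mem_lexMonomials {e : ℕ} {m : Fin (k + 1 + 1) →₀ ℕ} : m ∈ lexMonomials k H e ↔
    H (m 0 + m 1) ≤ m 0 ∨ ∃ j : Fin k, j.val < e ∧ m j.succ.succ ≠ 0 := Iff.rfl

lemma IsHVector.add_le (hH : IsHVector H) {t i : ℕ} (h : H t ≤ i) (hi : i ≤ t) (c : ℕ) :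
    H (t + c) ≤ i := by
  induction c with
  | zero => exact h
  | succ c ih => exact hH.succ_le (t + c) i ih (by omega)

lemma IsHVector.isUpperSet_lexMonomials (hH : IsHVector H) (e : ℕ) :
    IsUpperSet (lexMonomials k H e) := by
  intro m m' hmm' hm
  have h0 := hmm' 0
  have h1 := hmm' 1
  rcases hm with hm | ⟨j, hj, hm⟩
  · left
    have := hH.add_le hm (by omega) (m' 0 + m' 1 - (m 0 + m 1))
    rw [Nat.add_sub_cancel' (by omega)] at this
    omega
  · have := hmm' j.succ.succ
    exact Or.inr ⟨j, hj, by omega⟩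

/-- The extension to `R` of the lexicographic ideal of `K[x_0, x_1]` with Hilbert function `H`,
plus the ideal generated by the first `e` of the variables `x_2, x_3, …`. -/
noncomputable def lexIdeal (K : Type*) [Field K] (k : ℕ) (hH : IsHVector H) (e : ℕ) :
    Ideal (PolyRing K (k + 1)) :=
  restrictSupportIdeal (R := K) (lexMonomials k H e) (hH.isUpperSet_lexMonomials e)

variable (K) in
/-- The variables `x_2, …, x_n`. -/
noncomputable def lastVars (k : ℕ) : List (PolyRing K (k + 1)) :=
  List.ofFn fun j : Fin k => X j.succ.succ

lemma lexIdeal_eq_ofList_sup (hH : IsHVector H) (e : ℕ) :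
    lexIdeal K k hH e = Ideal.ofList ((lastVars K k).take e) ⊔ lexIdeal K k hH 0 := by
  apply le_antisymm
  · refine restrictSupportIdeal_le fun m hm => ?_
    rcases hm with hm | ⟨j, hj, hm⟩
    · exact Submodule.mem_sup_right (monomial_mem_restrictSupportIdeal (Or.inl hm))
    · refine Submodule.mem_sup_left (monomial_mem_of_X_mem (Ideal.subset_span ?_) hm)
      rw [Set.mem_ofPred_eq, List.mem_take_iff_getElem]
      exact ⟨j, by simp [lastVars, hj], by simp [lastVars]⟩
  · rw [sup_le_iff]
    constructor
    · rw [Ideal.ofList, Ideal.span_le]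
      intro x hx
      rw [Set.mem_ofPred_eq, List.mem_take_iff_getElem] at hx
      obtain ⟨i, hi, rfl⟩ := hx
      simp only [lastVars, List.length_ofFn, lt_inf_iff] at hi
      simp only [lastVars, List.getElem_ofFn]
      exact monomial_mem_restrictSupportIdeal (Or.inr ⟨⟨i, hi.2⟩, hi.1, by simp⟩)
    · refine restrictSupportIdeal_le fun m hm => monomial_mem_restrictSupportIdeal (Or.inl ?_)
      rcases hm with hm | ⟨j, hj, -⟩
      · exact hm
      · exact absurd hj (Nat.not_lt_zero _)

lemma single_succ_succ_zero (j : Fin k) (c : ℕ) :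
    (Finsupp.single j.succ.succ c : Fin (k + 1 + 1) →₀ ℕ) 0 = 0 :=
  Finsupp.single_eq_of_ne (Fin.succ_ne_zero _).symm

lemma single_succ_succ_one (j : Fin k) (c : ℕ) :
    (Finsupp.single j.succ.succ c : Fin (k + 1 + 1) →₀ ℕ) 1 = 0 :=
  Finsupp.single_eq_of_ne (by simp [Fin.ext_iff])

lemma X_mul_mem_lexIdeal_iff (hH : IsHVector H) (j : Fin k) {f : PolyRing K (k + 1)} :
    X j.succ.succ * f ∈ lexIdeal K k hH j ↔ f ∈ lexIdeal K k hH j := by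
  refine X_mul_mem_restrictSupportIdeal_iff fun m hm => ?_
  rcases hm with hm | ⟨i, hi, hm⟩
  · left
    simpa only [Finsupp.add_apply, single_succ_succ_zero, single_succ_succ_one, add_zero] using hm
  · refine Or.inr ⟨i, hi, ?_⟩
    have h2 : (Finsupp.single j.succ.succ 1 : Fin (k + 1 + 1) →₀ ℕ) i.succ.succ = 0 :=
      Finsupp.single_eq_of_ne (by simp only [Ne, Fin.ext_iff, Fin.val_succ]; omega)
    simpa only [Finsupp.add_apply, h2, add_zero] using hm

lemma mk_mem_smul_top_iff {R : Type*} [CommRing R] {L Q : Ideal R} {f : R} :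
    Ideal.Quotient.mk Q f ∈ (L • ⊤ : Submodule R (R ⧸ Q)) ↔ f ∈ L ⊔ Q := by
  have h : (L • ⊤ : Submodule R (R ⧸ Q)) = Submodule.map Q.mkQ L := by
    rw [← Submodule.range_mkQ Q, LinearMap.range_eq_map, ← Submodule.map_smul'', smul_eq_mul,
      Ideal.mul_top]
  change Q.mkQ f ∈ _ ↔ _
  rw [h, ← Submodule.mem_comap, Submodule.comap_map_mkQ, sup_comm]

lemma one_notMem_lexIdeal (hH : IsHVector H) (e : ℕ) :
    (1 : PolyRing K (k + 1)) ∉ lexIdeal K k hH e := by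
  intro h
  rcases mem_restrictSupportIdeal.1 h 0 (by simp) with h0 | ⟨j, -, h0⟩
  · simp [hH.zero] at h0
  · simp at h0

/-- The variables `x_2, …, x_n` form a regular sequence modulo the lexicographic ideal. -/
lemma isRegular_lastVars (hH : IsHVector H) :
    RingTheory.Sequence.IsRegular (PolyRing K (k + 1) ⧸ lexIdeal K k hH 0) (lastVars K k) := by
  refine ⟨⟨fun i hi => ?_⟩, fun h => ?_⟩
  · have hik : i < k := by simpa [lastVars] using hi
    rw [isSMulRegular_quotient_iff_mem_of_smul_mem]
    intro x hx
    obtain ⟨f, rfl⟩ := Ideal.Quotient.mk_surjective x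
    have hx' : Ideal.Quotient.mk (lexIdeal K k hH 0) ((lastVars K k)[i] * f) ∈
      (Ideal.ofList ((lastVars K k).take i) • ⊤ :
        Submodule (PolyRing K (k + 1)) (PolyRing K (k + 1) ⧸ lexIdeal K k hH 0)) := hx
    rw [mk_mem_smul_top_iff, ← lexIdeal_eq_ofList_sup] at hx' ⊢
    have hget : (lastVars K k)[i] = X (⟨i, hik⟩ : Fin k).succ.succ := by simp [lastVars]
    rw [hget] at hx'
    exact (X_mul_mem_lexIdeal_iff hH ⟨i, hik⟩).1 hx'
  · have h1 : Ideal.Quotient.mk (lexIdeal K k hH 0) 1 ∈ (Ideal.ofList (lastVars K k) • ⊤ :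
        Submodule (PolyRing K (k + 1)) (PolyRing K (k + 1) ⧸ lexIdeal K k hH 0)) := by
      rw [← h]; trivial
    have htake : (lastVars K k).take k = lastVars K k :=
      List.take_of_length_le (by simp [lastVars])
    rw [mk_mem_smul_top_iff, ← htake, ← lexIdeal_eq_ofList_sup] at h1
    exact one_notMem_lexIdeal hH k h1

/-! ### Codimension and dimension -/

variable (K k) in
/-- The ideal `(x_0, x_1)`. -/
noncomputable def firstVarsIdeal : Ideal (PolyRing K (k + 1)) := Ideal.span {X 0, X 1}

lemma X_zero_mem_firstVarsIdeal : X 0 ∈ firstVarsIdeal K k :=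
  Ideal.subset_span (Set.mem_insert _ _)

lemma X_one_mem_firstVarsIdeal : X 1 ∈ firstVarsIdeal K k :=
  Ideal.subset_span (Set.mem_insert_of_mem _ (Set.mem_singleton _))

lemma lexIdeal_le_firstVarsIdeal (hH : IsHVector H) :
    lexIdeal K k hH 0 ≤ firstVarsIdeal K k := by
  refine restrictSupportIdeal_le fun m hm => ?_
  rcases hm with hm | ⟨j, hj, -⟩
  · by_cases h0 : m 0 = 0
    · refine monomial_mem_of_X_mem X_one_mem_firstVarsIdeal (j := 1) fun h1 => ?_
      rw [h0, h1, hH.zero] at hm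
      omega
    · exact monomial_mem_of_X_mem X_zero_mem_firstVarsIdeal h0
  · exact absurd hj (Nat.not_lt_zero _)

/-- A prime ideal containing the lexicographic ideal contains `x_0` and `x_1`, as powers of these
lie in the lexicographic ideal. -/
lemma firstVarsIdeal_le_of_isPrime (hH : IsHVector H) {P : Ideal (PolyRing K (k + 1))}
    (hP : P.IsPrime) (h : lexIdeal K k hH 0 ≤ P) : firstVarsIdeal K k ≤ P := by
  obtain ⟨t, ht⟩ := hH.exists_eq_zero
  have key : ∀ j : Fin (k + 1 + 1), j = 0 ∨ j = 1 → X j ∈ P := by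
    intro j hj
    refine hP.mem_of_pow_mem t (h ?_)
    rw [X_pow_eq_monomial]
    refine monomial_mem_restrictSupportIdeal (Or.inl ?_)
    rcases hj with rfl | rfl <;> simp [ht]
  rw [firstVarsIdeal, Ideal.span_le]
  rintro x (rfl | rfl)
  · exact key 0 (Or.inl rfl)
  · exact key 1 (Or.inr rfl)

lemma firstVarsIdeal_ne_top : firstVarsIdeal K k ≠ ⊤ :=
  span_pair_ne_top (by simp) (by simp)

lemma height_lexIdeal (hH : IsHVector H) : (lexIdeal K k hH 0).height = 2 := by
  apply le_antisymm
  · exact (Ideal.height_mono (lexIdeal_le_firstVarsIdeal hH)).trans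
      (height_span_pair_le_two firstVarsIdeal_ne_top)
  · refine le_height_of_forall_isPrime fun P hP hle => ?_
    have h := firstVarsIdeal_le_of_isPrime hH hP hle
    refine two_le_height_of_isPrime (F := X 0) (G := X 1) (X_ne_zero _) ?_
      (h X_zero_mem_firstVarsIdeal) (h X_one_mem_firstVarsIdeal)
    refine (X_prime.irreducible.isRelPrime_iff_not_dvd).2 fun hdvd => ?_
    have := X_dvd_X.1 hdvd
    simp at this

lemma ringKrullDim_quotient_firstVarsIdeal :
    ringKrullDim (PolyRing K (k + 1) ⧸ firstVarsIdeal K k) = k := by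
  have hdim : ringKrullDim (MvPolynomial (Fin k) K) = k := by
    rw [MvPolynomial.ringKrullDim_of_isNoetherianRing, ringKrullDim_eq_zero_of_field]
    simp
  rw [← hdim]
  apply le_antisymm
  · let φ : MvPolynomial (Fin k) K →ₐ[K] PolyRing K (k + 1) ⧸ firstVarsIdeal K k :=
      (Ideal.Quotient.mkₐ K _).comp (rename fun j => j.succ.succ)
    have hφ : φ.comp ((killFirst K k).comp (killFirst K (k + 1))) = Ideal.Quotient.mkₐ K _ := by
      ext j
      rw [AlgHom.comp_apply, AlgHom.comp_apply, AlgHom.comp_apply]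
      refine Fin.cases ?_ (fun j => Fin.cases ?_ (fun j => ?_) j) j
      · rw [killFirst_X_zero, map_zero, map_zero]
        exact (Ideal.Quotient.eq_zero_iff_mem.2 X_zero_mem_firstVarsIdeal).symm
      · rw [killFirst_X_succ, killFirst_X_zero, map_zero]
        exact (Ideal.Quotient.eq_zero_iff_mem.2 X_one_mem_firstVarsIdeal).symm
      · rw [killFirst_X_succ, killFirst_X_succ]
        simp
    refine ringKrullDim_le_of_surjective φ.toRingHom fun x => ?_
    obtain ⟨f, rfl⟩ := Ideal.Quotient.mk_surjective x
    exact ⟨_, DFunLike.congr_fun hφ f⟩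
  · let ψ := (killFirst K k).comp (killFirst K (k + 1))
    have hψ : ∀ f ∈ firstVarsIdeal K k, ψ f = 0 := by
      intro f hf
      have : firstVarsIdeal K k ≤ RingHom.ker ψ := by
        rw [firstVarsIdeal, Ideal.span_le]
        rintro x (rfl | rfl)
        · change killFirst K k (killFirst K (k + 1) (X 0)) = 0
          rw [killFirst_X_zero, map_zero]
        · change killFirst K k (killFirst K (k + 1) (X (Fin.succ 0))) = 0
          rw [killFirst_X_succ, killFirst_X_zero]
      exact this hf
    refine ringKrullDim_le_of_surjective (Ideal.Quotient.liftₐ _ ψ hψ).toRingHom fun f => ?_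
    refine ⟨Ideal.Quotient.mk _ (rename Fin.succ (rename Fin.succ f)), ?_⟩
    change ψ (rename Fin.succ (rename Fin.succ f)) = f
    simp only [ψ, AlgHom.comp_apply, killFirst_rename]

lemma ringKrullDim_quotient_lexIdeal (hH : IsHVector H) :
    ringKrullDim (PolyRing K (k + 1) ⧸ lexIdeal K k hH 0) = k := by
  have h : PrimeSpectrum.zeroLocus (lexIdeal K k hH 0 : Set (PolyRing K (k + 1))) =
      PrimeSpectrum.zeroLocus (firstVarsIdeal K k : Set (PolyRing K (k + 1))) := by
    ext P
    simp only [PrimeSpectrum.mem_zeroLocus, SetLike.coe_subset_coe]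
    exact ⟨firstVarsIdeal_le_of_isPrime hH P.2, (lexIdeal_le_firstVarsIdeal hH).trans⟩
  rw [← ringKrullDim_quotient_firstVarsIdeal (K := K), ringKrullDim_quotient,
    ringKrullDim_quotient, h]

theorem isACMIdeal_lexIdeal (hH : IsHVector H) : IsACMIdeal 2 (lexIdeal K k hH 0) where
  homogeneous := isHomogeneousIdeal_restrictSupportIdeal _
  codim := height_lexIdeal hH
  cohenMacaulay := by
    refine ⟨lastVars K k, fun f hf => ?_, isRegular_lastVars hH, ?_⟩
    · obtain ⟨j, rfl⟩ := List.mem_ofFn.1 hf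
      exact Ideal.subset_span ⟨_, rfl⟩
    · rw [ringKrullDim_quotient_lexIdeal, lastVars, List.length_ofFn]
      rfl
  saturated := by
    intro hk f hf
    have h := hf (⟨0, by omega⟩ : Fin k).succ.succ
    exact (X_mul_mem_lexIdeal_iff hH ⟨0, by omega⟩).1 h

/-- In degree `t`, the monomials in `x_0` and `x_1` outside the lexicographic ideal are the
`x_0^i x_1^(t-i)` with `i < H t`. -/
lemma quotSeries_lexIdeal_mul (hH : IsHVector H) :
    quotSeries (lexIdeal K k hH 0) * (1 - PowerSeries.X) ^ k =
      PowerSeries.mk fun t => (H t : ℤ) := by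
  classical
  let s : Finset (Fin (k + 1 + 1)) :=
    Finset.univ.image fun j : Fin k => j.succ.succ
  have hs : s.card = k := by
    have hinj : Function.Injective fun j : Fin k => j.succ.succ :=
      fun a b h => Fin.succ_injective _ (Fin.succ_injective _ h)
    rw [Finset.card_image_of_injective _ hinj, Finset.card_univ, Fintype.card_fin]
  have hmem : ∀ m : Fin (k + 1 + 1) →₀ ℕ, m ∈ (lexMonomials k H 0)ᶜ ↔ m 0 < H (m 0 + m 1) := by
    intro m
    rw [Set.mem_compl_iff, mem_lexMonomials]
    simp
  have h := countSeries_mul_one_sub_pow (V := (lexMonomials k H 0)ᶜ) s (by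
    intro j hj m
    obtain ⟨j, -, rfl⟩ := Finset.mem_image.1 hj
    rw [hmem, hmem]
    rw [Finsupp.add_apply, Finsupp.add_apply, single_succ_succ_zero, single_succ_succ_one]
    rfl)
  rw [hs] at h
  rw [lexIdeal, quotSeries_restrictSupportIdeal, h]
  ext t
  rw [countSeries, PowerSeries.coeff_mk, PowerSeries.coeff_mk]
  let g : ℕ → (Fin (k + 1 + 1) →₀ ℕ) := fun i =>
    Finsupp.single 0 i + Finsupp.single 1 (t - i)
  have hg0 : ∀ i, g i 0 = i := fun i => by simp [g]
  have hg1 : ∀ i, g i 1 = t - i := fun i => by simp [g]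
  have hg2 : ∀ i (j : Fin k), g i j.succ.succ = 0 := fun i j => by
    have h1 : j.succ.succ ≠ (1 : Fin (k + 1 + 1)) := by simp [Fin.ext_iff]
    rw [Finsupp.add_apply, Finsupp.single_eq_of_ne (Fin.succ_ne_zero _),
      Finsupp.single_eq_of_ne h1, add_zero]
  have hginj : Function.Injective g := fun i i' h => by rw [← hg0 i, h, hg0]
  have hset : (lexMonomials k H 0)ᶜ ∩ {m | ∀ j ∈ s, m j = 0} ∩ {m | m.degree = t} =
      g '' (Finset.range (H t) : Set ℕ) := by
    ext m
    simp only [Set.mem_inter_iff, hmem, Set.mem_ofPred_eq, Set.mem_image, Finset.coe_range,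
      Set.mem_Iio]
    constructor
    · rintro ⟨⟨h1, h2⟩, h3⟩
      have h4 : ∀ j : Fin k, m j.succ.succ = 0 := fun j =>
        h2 _ (Finset.mem_image.2 ⟨j, Finset.mem_univ _, rfl⟩)
      have h5 : m 0 + m 1 = t := by
        rw [← h3, Finsupp.degree_eq_sum, Fin.sum_univ_succ, Fin.sum_univ_succ]
        simp [h4]
      refine ⟨m 0, by rwa [h5] at h1, ?_⟩
      ext j
      refine Fin.cases ?_ (fun j => Fin.cases ?_ (fun j => ?_) j) j
      · exact hg0 _
      · have := hg1 (m 0)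
        change g (m 0) 1 = m 1
        omega
      · rw [h4]
        exact hg2 _ _
    · rintro ⟨i, hi, rfl⟩
      have hit : i ≤ t := by have := hH.le_succ t; omega
      refine ⟨⟨?_, fun j hj => ?_⟩, ?_⟩
      · rw [hg0, hg1, Nat.add_sub_cancel' hit]
        exact hi
      · obtain ⟨j, -, rfl⟩ := Finset.mem_image.1 hj
        exact hg2 _ _
      · simp only [g, map_add, Finsupp.degree_single]
        omega
  rw [hset, Set.ncard_image_of_injective _ hginj, Set.ncard_coe_finset, Finset.card_range]

end LexIdeal

/-! ### The algorithm -/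

section Algorithm

variable {I J : Ideal (PolyRing K n)}

/-- If no diagonal entry is negative, the Hilbert series of `R/I` is that of the quotient by a
lexicographic ideal in `x_0` and `x_1`, which is arithmetically Cohen-Macaulay. -/
theorem isNumericallyACM_of_numNegative_eq_zero [Infinite K] (ρ : MinimalFreeResolution I)
    (hI : IsHomogeneousIdeal I) (hproper : I ≠ ⊤) (h2 : 2 ≤ I.height)
    (h0 : ρ.numNegative = 0) : IsNumericallyACM I := by
  obtain ⟨H, p, hH, hp, hnum⟩ := ρ.exists_isHVector_of_numNegative_eq_zero hI hproper
    (ρ.one_sub_X_sq_dvd_numerator hI hproper h2) h0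
  obtain ⟨k, rfl⟩ : ∃ k, n = k + 1 :=
    ⟨n - 1, by have := one_le_of_two_le_height hproper h2; omega⟩
  refine ⟨hI, lexIdeal K k hH 0, isACMIdeal_lexIdeal hH, ?_⟩
  have hpH : (PowerSeries.mk fun t => (H t : ℤ)) = (p : PowerSeries ℤ) := by
    ext t
    rw [PowerSeries.coeff_mk, hp, Polynomial.coeff_coe]
  have hser : quotSeries I = quotSeries (lexIdeal K k hH 0) := by
    apply mul_right_cancel₀ (pow_ne_zero (k + 1 + 1) one_sub_X_ne_zero)
    rw [ρ.quotSeries_mul, hnum, pow_add _ k 2, ← mul_assoc, quotSeries_lexIdeal_mul, hpH]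
    simp
  funext t
  have ht := congrArg (PowerSeries.coeff t) hser
  rw [quotSeries, quotSeries, PowerSeries.coeff_mk, PowerSeries.coeff_mk] at ht
  exact_mod_cast ht

lemma forGeneralForm_isRelPrime_of_mem (hproper : I ≠ ⊤)
    (h2 : 2 ≤ I.height) (d : ℕ) {F : PolyRing K n} (hF : F ∈ I) (hF0 : F ≠ 0) :
    ForGeneralForm d (fun G => G ≠ 0 ∧ IsRelPrime F G) := by
  refine forGeneralForm_isRelPrime (one_le_of_two_le_height hproper h2) d hF0 fun hu => ?_
  exact hproper (Ideal.eq_top_of_isUnit_mem _ hF hu)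

lemma exists_algorithmStep [Infinite K] (ρ : MinimalFreeResolution I)
    (hproper : I ≠ ⊤) (h2 : 2 ≤ I.height) (hpos : 0 < ρ.numNegative) :
    ∃ J, AlgorithmStep I J := by
  obtain ⟨i, r, d, h⟩ := ρ.exists_isFirstNegative hpos
  obtain ⟨F, hFI, hF0, hF⟩ := ρ.exists_form_of_coeff_pos h.coeff_pos
  obtain ⟨G, hG, hG0, hFG⟩ :=
    (forGeneralForm_isRelPrime_of_mem hproper h2 d hFI hF0).exists
  exact ⟨_, ρ, i, r, d, h, F, G, hFI, hF0, hF, h.2.1, hG0, hG, hFG, rfl⟩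

/-- The ideals to which the algorithm applies. -/
structure IsAdmissible (I : Ideal (PolyRing K n)) : Prop where
  homogeneous : IsHomogeneousIdeal I
  ne_top : I ≠ ⊤
  two_le_height : 2 ≤ I.height

lemma AlgorithmStep.isAdmissible (h : AlgorithmStep I J) (hI : IsAdmissible I) :
    IsAdmissible J := by
  obtain ⟨_, _, _, _, _, h⟩ := h
  obtain ⟨h1, h2⟩ := height_basicDoubleLink hI.homogeneous hI.ne_top hI.two_le_height h
  exact ⟨isHomogeneousIdeal_basicDoubleLink hI.homogeneous h, h1, h2.ge⟩

lemma AlgorithmStep.numNegative_eq (h : AlgorithmStep I J) (hI : IsAdmissible I)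
    (ρ : MinimalFreeResolution I) (ρ' : MinimalFreeResolution J) :
    ρ'.numNegative + 1 = ρ.numNegative := by
  obtain ⟨ρ₁, i, r, d, h, hJ⟩ := h
  rw [ρ.numNegative_eq ρ₁]
  exact MinimalFreeResolution.IsFirstNegative.numNegative_eq hI.homogeneous h hJ ρ'

/-- Every pass of the algorithm lowers the number of negative diagonal entries by one. -/
lemma IsAlgorithmRun.invariant {N : ℕ} {S : ℕ → Ideal (PolyRing K n)}
    (h : IsAlgorithmRun I N S) (hI : IsAdmissible I) (ρ : MinimalFreeResolution I) :
    ∀ k ≤ N, IsAdmissible (S k) ∧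
      ∀ ρ' : MinimalFreeResolution (S k), ρ'.numNegative + k = ρ.numNegative := by
  obtain ⟨rfl, h⟩ := h
  intro k
  induction k with
  | zero => exact fun _ => ⟨hI, fun ρ' => ρ'.numNegative_eq ρ⟩
  | succ k ih =>
    intro hk
    obtain ⟨h1, h2⟩ := ih (by omega)
    refine ⟨(h k hk).isAdmissible h1, fun ρ' => ?_⟩
    obtain ⟨ρ₁⟩ := exists_minimalFreeResolution h1.homogeneous h1.ne_top
    have := h2 ρ₁
    have := (h k hk).numNegative_eq h1 ρ₁ ρ'
    omega

lemma exists_isAlgorithmRun [Infinite K] (hI : IsAdmissible I) (ρ : MinimalFreeResolution I) :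
    ∀ N ≤ ρ.numNegative, ∃ S, IsAlgorithmRun I N S := by
  intro N
  induction N with
  | zero => exact fun _ => ⟨fun _ => I, rfl, fun k hk => absurd hk (Nat.not_lt_zero k)⟩
  | succ N ih =>
    intro hN
    obtain ⟨S, hS⟩ := ih (by omega)
    obtain ⟨h1, h2⟩ := hS.invariant hI ρ N le_rfl
    obtain ⟨ρ₁⟩ := exists_minimalFreeResolution h1.homogeneous h1.ne_top
    obtain ⟨J, hJ⟩ := exists_algorithmStep ρ₁ h1.ne_top h1.two_le_height
      (by have := h2 ρ₁; omega)
    refine ⟨Function.update S (N + 1) J, ?_, fun k hk => ?_⟩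
    · rw [Function.update_of_ne (Nat.succ_ne_zero N).symm]
      exact hS.1
    · rw [Function.update_of_ne (by omega : k ≠ N + 1)]
      rcases Nat.lt_succ_iff_lt_or_eq.1 hk with hk | rfl
      · rw [Function.update_of_ne (by omega : k + 1 ≠ N + 1)]
        exact hS.2 k hk
      · rwa [Function.update_self]

lemma IsAlgorithmRun.algorithmStops_iff {N : ℕ} {S : ℕ → Ideal (PolyRing K n)}
    (h : IsAlgorithmRun I N S) (hI : IsAdmissible I) (ρ : MinimalFreeResolution I) :
    AlgorithmStops (S N) ↔ N = ρ.numNegative := by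
  obtain ⟨h1, h2⟩ := h.invariant hI ρ N le_rfl
  constructor
  · rintro ⟨ρ', h0⟩
    rw [← h2 ρ', h0, zero_add]
  · intro hN
    obtain ⟨ρ'⟩ := exists_minimalFreeResolution h1.homogeneous h1.ne_top
    exact ⟨ρ', by have := h2 ρ'; omega⟩

lemma IsNumericalMacaulification.isNumericallyACM [Infinite K] (h : IsNumericalMacaulification I J)
    (hI : IsAdmissible I) : IsNumericallyACM J := by
  obtain ⟨ρ⟩ := exists_minimalFreeResolution hI.homogeneous hI.ne_top
  obtain ⟨N, S, hS, rfl, ρ', h0⟩ := h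
  obtain ⟨h1, -⟩ := hS.invariant hI ρ N le_rfl
  exact isNumericallyACM_of_numNegative_eq_zero ρ' h1.homogeneous h1.ne_top h1.two_le_height h0

lemma IsAlgorithmRun.reflTransGen {N : ℕ} {S : ℕ → Ideal (PolyRing K n)}
    (h : IsAlgorithmRun I N S) :
    Relation.ReflTransGen (fun I₁ I₂ => ∃ d a, IsBasicDoubleLink d a I₁ I₂) I (S N) := by
  obtain ⟨rfl, h⟩ := h
  induction N with
  | zero => exact .refl
  | succ N ih =>
    obtain ⟨-, -, r, d, -, hJ⟩ := h N N.lt_succ_self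
    exact .tail (ih fun k hk => h k (hk.trans N.lt_succ_self)) ⟨r, d, hJ⟩

lemma exists_isNumericalMacaulification [Infinite K] (hI : IsAdmissible I) :
    ∃ J, IsNumericalMacaulification I J := by
  obtain ⟨ρ⟩ := exists_minimalFreeResolution hI.homogeneous hI.ne_top
  obtain ⟨S, hS⟩ := exists_isAlgorithmRun hI ρ _ le_rfl
  exact ⟨_, _, S, hS, rfl, (hS.algorithmStops_iff hI ρ).2 rfl⟩

end Algorithm

end NumMac

theorem mainTheorem1 {K : Type*} [Field K] [Infinite K] {n : ℕ}
    (I : Ideal (NumMac.PolyRing K n)) (hI : NumMac.IsHomogeneousIdeal I)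
    (hproper : I ≠ ⊤) (hcodim : 2 ≤ I.height) :
    -- a finite sequence of basic double links leads to a numerically ACM ideal
    (∃ J : Ideal (NumMac.PolyRing K n),
      Relation.ReflTransGen (fun I₁ I₂ => ∃ d a, NumMac.IsBasicDoubleLink d a I₁ I₂) I J ∧
      NumMac.IsNumericallyACM J) ∧
    -- the algorithm can be applied: a minimal free resolution exists
    Nonempty (NumMac.MinimalFreeResolution I) ∧
    -- one pass of the algorithm
    (∀ (ρ : NumMac.MinimalFreeResolution I) (i r d : ℕ), ρ.IsFirstNegative i r d →
      (∃ F ∈ I, F ≠ 0 ∧ F.IsHomogeneous r) ∧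
      (∀ F ∈ I, F ≠ 0 → F.IsHomogeneous r →
        NumMac.ForGeneralForm d (fun G => G ≠ 0 ∧ IsRelPrime F G)) ∧
      (∀ J : Ideal (NumMac.PolyRing K n), NumMac.IsBasicDoubleLink r d I J →
        NumMac.IsHomogeneousIdeal J ∧ J.height = 2 ∧
        ∀ ρ' : NumMac.MinimalFreeResolution J, ρ'.diagonal = ρ.diagonal.eraseIdx i)) ∧
    -- the whole algorithm: it stops after exactly as many passes as there are negative diagonal
    -- entries at the start, whatever choices are made
    (∀ ρ : NumMac.MinimalFreeResolution I,
      (∀ N S, NumMac.IsAlgorithmRun I N S →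
        N ≤ ρ.numNegative ∧
        (NumMac.AlgorithmStops (S N) ↔ N = ρ.numNegative) ∧
        (N < ρ.numNegative → ∃ J, NumMac.AlgorithmStep (S N) J)) ∧
      ∃ S, NumMac.IsAlgorithmRun I ρ.numNegative S) ∧
    -- its output, the numerical Macaulification, exists and is numerically ACM
    (∃ J, NumMac.IsNumericalMacaulification I J) ∧
    ∀ J, NumMac.IsNumericalMacaulification I J → NumMac.IsNumericallyACM J := by
  have hadm : NumMac.IsAdmissible I := ⟨hI, hproper, hcodim⟩
  obtain ⟨J, N, S, hS, hJ, hfinal⟩ := NumMac.exists_isNumericalMacaulification hadm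
  refine ⟨⟨J, hJ ▸ hS.reflTransGen, ?_⟩, NumMac.exists_minimalFreeResolution hI hproper, ?_, ?_,
    ⟨J, N, S, hS, hJ, hfinal⟩, fun J' hJ' => hJ'.isNumericallyACM hadm⟩
  · exact NumMac.IsNumericalMacaulification.isNumericallyACM ⟨N, S, hS, hJ, hfinal⟩ hadm
  · intro ρ i r d h
    refine ⟨ρ.exists_form_of_coeff_pos h.coeff_pos, fun F hF hF0 _ =>
      NumMac.forGeneralForm_isRelPrime_of_mem hproper hcodim d hF hF0, fun J' hJ' => ?_⟩
    exact ⟨NumMac.isHomogeneousIdeal_basicDoubleLink hI hJ',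
      (NumMac.height_basicDoubleLink hI hproper hcodim hJ').2,
      fun ρ' => h.diagonal_eq_eraseIdx hI hJ' ρ'⟩
  · intro ρ
    refine ⟨fun N S hS => ?_, NumMac.exists_isAlgorithmRun hadm ρ _ le_rfl⟩
    obtain ⟨h1, h2⟩ := hS.invariant hadm ρ N le_rfl
    obtain ⟨ρ'⟩ := NumMac.exists_minimalFreeResolution h1.homogeneous h1.ne_top
    have hN := h2 ρ'
    refine ⟨by omega, hS.algorithmStops_iff hadm ρ, fun hlt => ?_⟩
    exact NumMac.exists_algorithmStep ρ' h1.ne_top h1.two_le_height (by omega)
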